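/- Let $0<q<1$ and $\tau,\sigma,\phi\in\mathbb R$. **Setting.** $\mathcal A_q(SU(2))$ is the complex unital algebra generated by $\alpha,\beta,\gamma,\delta$ with relations $\alpha\beta=q\beta\alpha$, $\alpha\gamma=q\gamma\alpha$, $\beta\delta=q\delta\beta$, $\gamma\delta=q\delta\gamma$, $\beta\gamma=\gamma\beta$, $\alpha\delta-q\beta\gamma=\delta\alpha-q^{-1}\beta\gamma=1$, and with comultiplication $\Delta(\alpha)=\alpha\otimes\alpha+\beta\otimes\gamma$, $\Delta(\beta)=\alpha\otimes\beta+\beta\otimes\delta$, $\Delta(\gamma)=\gamma\otimes\alpha+\delta\otimes\gamma$, $\Delta(\delta)=\gamma\otimes\beta+\delta\otimes\delta$. Let $\pi$ be its representation by bounded operators on $\ell^2(\mathbb Z_+)$, with standard orthonormal basis $(e_n)_{n\ge0}$, given by $\pi(\alpha)e_n=\sqrt{1-q^{2n}}\,e_{n-1}$ (where $e_{-1}=0$), $\pi(\gamma)e_n=q^ne_n$, $\pi(\delta)=\pi(\alpha)^*$, $\pi(\beta)=-q\,\pi(\gamma)$. Let $\tau_\theta\colon\mathcal A_q(SU(2))\to\mathbb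 C$ be the homomorphism with $\alpha\mapsto e^{i\theta}$, $\delta\mapsto e^{-i\theta}$, $\beta,\gamma\mapsto0$. Put $$\alpha_{\tau,\sigma}=q^{1/2}\alpha-iq^{\sigma-1/2}\beta+iq^{\tau+1/2}\gamma+q^{\sigma+\tau-1/2}\delta,\qquad \delta_{\tau,\sigma}=q^{\tau+\sigma+1/2}\alpha+iq^{\tau-1/2}\beta-iq^{\sigma+1/2}\gamma+q^{-1/2}\delta,$$ $$\beta_{\tau,\infty}=-iq^{-1/2}\beta+q^{\tau-1/2}\delta,\qquad \gamma_{\tau,\infty}=-q^{\tau+1/2}\alpha+iq^{1/2}\gamma,$$ $$\rho_{\tau,\sigma}=\tfrac12\bigl(q^{-\tau-\sigma-1}\alpha_{\tau+1,\sigma+1}\delta_{\tau,\sigma}-q^{-\tau-\sigma-1}-q^{\tau+\sigma+1}\bigr),\qquad \rho_{\tau,\infty}=q^{-1}\beta_{\tau+1,\infty}\gamma_{\tau,\infty}+q^{2\tau}.$$ Write $(a;p)_n=\prod_{j=0}^{n-1}(1-ap^j)$ for $0\le n\le\infty$ and $(a,b;p)_n=(a;p)_n(b;p)_n$. The Al-Salam–Chihara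 polynomials $h_n(x;s,t|p)$ are the Askey–Wilson polynomials with two parameters equal to zero and the other two equal to $a=p^{1/2}t/s$ and $c=-p^{1/2}/(st)$; that is, for $x=\cos\theta$, $$h_n(x;s,t|p)=a^{-n}(ac;p)_n\sum_{k=0}^n\frac{(p^{-n};p)_k\,(ae^{i\theta},ae^{-i\theta};p)_k}{(ac;p)_k\,(p;p)_k}\,p^k ,\qquad (ae^{i\theta},ae^{-i\theta};p)_k=\prod_{j=0}^{k-1}(1-2axp^j+a^2p^{2j}),$$ where the last product defines $h_n(x;s,t|p)$ as a polynomial in all $x\in\mathbb R$. **Proposition 3.3.** 1. For every $n\in\mathbb Z_+$ there is exactly one vector $v_n=v_n(q^\tau)\in\ell^2(\mathbb Z_+)$ with $\pi(\rho_{\tau,\infty})v_n=-q^{2n}v_n$ and $\langle v_n,e_0\rangle=1$. Let $V_1$ be the closed linear span of $\{v_n\mid n\ge0\}$. 2. There is exactly one positive Borel measure $dm$ on $\mathbb R$ with finite moments and total mass $\int_{\mathbb R}dm=(-q^{2\tau};q^2)_\infty$ for which $\int_{\mathbb R}h_nh_k\,dm=0$ whenever $n\ne k$, where $h_n=h_n(\cdot;q^\tau,q^\sigma|q^2)$.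 3. The multiplication operator $(Mf)(x)=xf(x)$ is a bounded operator on the complex Hilbert space $L^2(dm)$, and the map $$\Lambda\colon v_n(q^\tau)\longmapsto q^{-n}e^{in\phi}\,h_n(\cdot;q^\tau,q^\sigma|q^2),\qquad n\in\mathbb Z_+,$$ extends to a unitary operator $\Lambda$ from $V_1$ onto $L^2(dm)$. Moreover, the operator $T=(\pi\otimes\tau_{\phi/2})\Delta(\rho_{\tau,\sigma})$ maps $V_1$ into $V_1$, and $\Lambda T=M\Lambda$ on $V_1$. -/

import Mathlib

open scoped TensorProduct ENNReal
open MeasureTheory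

noncomputable section

namespace QSU2

/-! ### The algebra `A_q(SU(2))` -/

/-- Names of the four generators of `A_q(SU(2))`. -/
inductive Gen : Type
  | a | b | c | d

/-- The free generators. -/
abbrev fα : FreeAlgebra ℂ Gen := FreeAlgebra.ι ℂ Gen.a
abbrev fβ : FreeAlgebra ℂ Gen := FreeAlgebra.ι ℂ Gen.b
abbrev fγ : FreeAlgebra ℂ Gen := FreeAlgebra.ι ℂ Gen.c
abbrev fδ : FreeAlgebra ℂ Gen := FreeAlgebra.ι ℂ Gen.d

/-- The defining relations
`αβ = qβα`, `αγ = qγα`, `βδ = qδβ`, `γδ = qδγ`, `βγ = γβ`,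
`αδ - qβγ = 1`, `δα - q⁻¹βγ = 1`. -/
inductive Rel (q : ℝ) : FreeAlgebra ℂ Gen → FreeAlgebra ℂ Gen → Prop
  | ab : Rel q (fα * fβ) ((q : ℂ) • (fβ * fα))
  | ac : Rel q (fα * fγ) ((q : ℂ) • (fγ * fα))
  | bd : Rel q (fβ * fδ) ((q : ℂ) • (fδ * fβ))
  | cd : Rel q (fγ * fδ) ((q : ℂ) • (fδ * fγ))
  | bc : Rel q (fβ * fγ) (fγ * fβ)
  | ad : Rel q (fα * fδ - (q : ℂ) • (fβ * fγ)) 1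
  | da : Rel q (fδ * fα - (q : ℂ)⁻¹ • (fβ * fγ)) 1

/-- `A_q(SU(2))`: the complex unital associative algebra generated by `α, β, γ, δ` subject to
the relations above. -/
abbrev Aq (q : ℝ) : Type := RingQuot (Rel q)

/-- The generator `α`. -/
def gα (q : ℝ) : Aq q := RingQuot.mkAlgHom ℂ (Rel q) fα
/-- The generator `β`. -/
def gβ (q : ℝ) : Aq q := RingQuot.mkAlgHom ℂ (Rel q) fβ
/-- The generator `γ`. -/
def gγ (q : ℝ) : Aq q := RingQuot.mkAlgHom ℂ (Rel q) fγ
/-- The generator `δ`. -/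
def gδ (q : ℝ) : Aq q := RingQuot.mkAlgHom ℂ (Rel q) fδ

/-- The relations of `A_q(SU(2))`, for four elements of an arbitrary complex algebra. -/
structure Satisfies (q : ℝ) {B : Type*} [Ring B] [Algebra ℂ B] (a b c d : B) : Prop where
  ab : a * b = (q : ℂ) • (b * a)
  ac : a * c = (q : ℂ) • (c * a)
  bd : b * d = (q : ℂ) • (d * b)
  cd : c * d = (q : ℂ) • (d * c)
  bc : b * c = c * b
  ad : a * d - (q : ℂ) • (b * c) = 1
  da : d * a - (q : ℂ)⁻¹ • (b * c) = 1

theorem satisfies_gen (q : ℝ) : Satisfies q (gα q) (gβ q) (gγ q) (gδ q) := by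
  have h := @RingQuot.mkAlgHom_rel ℂ _ (FreeAlgebra ℂ Gen) _ _ (Rel q)
  constructor <;>
    simp only [gα, gβ, gγ, gδ, ← map_mul, ← map_smul, ← map_sub,
      ← map_one (RingQuot.mkAlgHom ℂ (Rel q))]
  · exact h Rel.ab
  · exact h Rel.ac
  · exact h Rel.bd
  · exact h Rel.cd
  · exact h Rel.bc
  · exact h Rel.ad
  · exact h Rel.da

/-- The values of a homomorphism on the generators. -/
def genVal {B : Type*} (a b c d : B) : Gen → B
  | Gen.a => a
  | Gen.b => b
  | Gen.c => c
  | Gen.d => d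

/-- The algebra homomorphism out of `A_q(SU(2))` with prescribed values on the generators. -/
def liftAq {q : ℝ} {B : Type*} [Ring B] [Algebra ℂ B] {a b c d : B}
    (h : Satisfies q a b c d) : Aq q →ₐ[ℂ] B :=
  RingQuot.liftAlgHom ℂ ⟨FreeAlgebra.lift ℂ (genVal a b c d), by
    intro x y hxy
    cases hxy <;> simp only [map_mul, map_sub, map_smul, map_one, FreeAlgebra.lift_ι_apply, genVal]
    · exact h.ab
    · exact h.ac
    · exact h.bd
    · exact h.cd
    · exact h.bc
    · exact h.ad
    · exact h.da⟩

section lift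
variable {q : ℝ} {B : Type*} [Ring B] [Algebra ℂ B] {a b c d : B} (h : Satisfies q a b c d)

theorem liftAq_gα : liftAq h (gα q) = a := by
  simp [liftAq, gα, RingQuot.liftAlgHom_mkAlgHom_apply, genVal]
theorem liftAq_gβ : liftAq h (gβ q) = b := by
  simp [liftAq, gβ, RingQuot.liftAlgHom_mkAlgHom_apply, genVal]
theorem liftAq_gγ : liftAq h (gγ q) = c := by
  simp [liftAq, gγ, RingQuot.liftAlgHom_mkAlgHom_apply, genVal]
theorem liftAq_gδ : liftAq h (gδ q) = d := by
  simp [liftAq, gδ, RingQuot.liftAlgHom_mkAlgHom_apply, genVal]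

end lift

/-! ### The comultiplication -/

theorem satisfies_comul {q : ℝ} (hq : q ∈ Set.Ioo (0 : ℝ) 1) :
    Satisfies q (B := Aq q ⊗[ℂ] Aq q)
      (gα q ⊗ₜ[ℂ] gα q + gβ q ⊗ₜ[ℂ] gγ q) (gα q ⊗ₜ[ℂ] gβ q + gβ q ⊗ₜ[ℂ] gδ q)
      (gγ q ⊗ₜ[ℂ] gα q + gδ q ⊗ₜ[ℂ] gγ q) (gγ q ⊗ₜ[ℂ] gβ q + gδ q ⊗ₜ[ℂ] gδ q) := by
  have hq0 : (q : ℂ) ≠ 0 := by exact_mod_cast hq.1.ne'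
  obtain ⟨ab, ac, bd, cd, bc, ad, da⟩ := satisfies_gen q
  have ad' : gα q * gδ q = 1 + (q : ℂ) • (gβ q * gγ q) := by rw [← ad]; abel
  have da' : gδ q * gα q = 1 + (q : ℂ)⁻¹ • (gβ q * gγ q) := by rw [← da]; abel
  constructor <;> try rw [sub_eq_iff_eq_add]
  all_goals
    simp only [add_mul, mul_add, Algebra.TensorProduct.tmul_mul_tmul, ab, ac, bd, cd, ad', da',
      ← bc, ← TensorProduct.smul_tmul', TensorProduct.tmul_smul, TensorProduct.tmul_add,
      TensorProduct.add_tmul, smul_add, smul_smul, Algebra.TensorProduct.one_def]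
    match_scalars <;> try field_simp

/-- The comultiplication `Δ`, i.e. the algebra homomorphism with
`Δ(α) = α⊗α + β⊗γ`, `Δ(β) = α⊗β + β⊗δ`, `Δ(γ) = γ⊗α + δ⊗γ`, `Δ(δ) = γ⊗β + δ⊗δ`.
(The values on `β = -q γ*` and `δ = α*` are those of a `*`-homomorphism.) -/
def comul {q : ℝ} (hq : q ∈ Set.Ioo (0 : ℝ) 1) : Aq q →ₐ[ℂ] Aq q ⊗[ℂ] Aq q :=
  liftAq (satisfies_comul hq)

/-! ### The one-dimensional representations -/

theorem satisfies_char (q θ : ℝ) :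
    Satisfies q (B := ℂ) (Complex.exp (Complex.I * θ)) 0 0 (Complex.exp (-(Complex.I * θ))) := by
  constructor <;> simp [← Complex.exp_add]

/-- The one-dimensional `*`-representation `τ_θ`: `α ↦ e^{iθ}`, `γ ↦ 0`
(hence `δ ↦ e^{-iθ}`, `β ↦ 0`). -/
def oneDim (q θ : ℝ) : Aq q →ₐ[ℂ] ℂ := liftAq (satisfies_char q θ)

/-! ### The infinite-dimensional representation on `ℓ²(ℤ₊)` -/

/-- The Hilbert space `ℓ²(ℤ₊)`. -/
abbrev Ell2 : Type := lp (fun _ : ℕ => ℂ) 2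

/-- The standard orthonormal basis vectors `e_n`. -/
def e (n : ℕ) : Ell2 := lp.single 2 n 1

/-- A square summable sequence as an element of `ℓ²(ℤ₊)`. -/
def mkEll2 (f : ℕ → ℂ) (hf : Summable fun k => ‖f k‖ ^ 2) : Ell2 :=
  ⟨f, by
    refine memℓp_gen ?_
    simpa using hf⟩

theorem Ell2.summable_sq (x : Ell2) : Summable fun k => ‖x k‖ ^ 2 := by
  have h := (lp.memℓp x).summable (by norm_num)
  simpa using h

theorem Ell2.norm_sq (x : Ell2) : ‖x‖ ^ 2 = ∑' k, ‖x k‖ ^ 2 := by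
  have h := lp.norm_rpow_eq_tsum (p := 2) (by norm_num) x
  simpa using h

/-- A bounded operator on `ℓ²(ℤ₊)` from a coordinatewise description. -/
def mkOp (f : (ℕ → ℂ) →ₗ[ℂ] (ℕ → ℂ))
    (hf : ∀ x : Ell2, Summable (fun k => ‖f x k‖ ^ 2) ∧
      ∑' k, ‖f x k‖ ^ 2 ≤ ∑' k, ‖x k‖ ^ 2) : Ell2 →L[ℂ] Ell2 :=
  LinearMap.mkContinuous
    { toFun := fun x => mkEll2 (f x) (hf x).1
      map_add' := fun x y => by
        ext k
        exact congrFun (f.map_add (x : ℕ → ℂ) y) k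
      map_smul' := fun c x => by
        ext k
        exact congrFun (f.map_smul c (x : ℕ → ℂ)) k } 1 (fun x => by
    rw [one_mul]
    refine le_of_sq_le_sq ?_ (norm_nonneg _)
    rw [Ell2.norm_sq, Ell2.norm_sq]
    exact (hf x).2)

theorem mkOp_apply (f : (ℕ → ℂ) →ₗ[ℂ] (ℕ → ℂ)) (hf) (x : Ell2) (k : ℕ) :
    mkOp f hf x k = f x k := rfl

theorem weight_sq_le {w : ℝ} (h0 : 0 ≤ w) (h1 : w ≤ 1) (z : ℂ) :
    ‖(w : ℂ) * z‖ ^ 2 ≤ ‖z‖ ^ 2 := by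
  rw [norm_mul, Complex.norm_real, Real.norm_of_nonneg h0]
  gcongr
  exact mul_le_of_le_one_left (norm_nonneg z) h1

/-- The weight `√(1 - q^{2n})`. -/
def wt (q : ℝ) (n : ℕ) : ℝ := √(1 - q ^ (2 * n))

theorem wt_le_one {q : ℝ} (hq : q ∈ Set.Ioo (0 : ℝ) 1) (n : ℕ) : wt q n ≤ 1 := by
  have := pow_nonneg hq.1.le (2 * n)
  exact Real.sqrt_le_one.mpr (by linarith)

theorem wt_sq {q : ℝ} (hq : q ∈ Set.Ioo (0 : ℝ) 1) (n : ℕ) : wt q n * wt q n = 1 - q ^ (2 * n) :=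
  Real.mul_self_sqrt (by have := pow_le_one₀ (n := 2 * n) hq.1.le hq.2.le; linarith)

/-- `π(α)`: `(π(α) x)_k = √(1-q^{2k+2}) x_{k+1}`, i.e. `π(α) e_n = √(1-q^{2n}) e_{n-1}`. -/
def opα {q : ℝ} (hq : q ∈ Set.Ioo (0 : ℝ) 1) : Ell2 →L[ℂ] Ell2 :=
  mkOp
    { toFun := fun x k => (wt q (k + 1) : ℂ) * x (k + 1)
      map_add' := fun x y => by ext k; simp [mul_add]
      map_smul' := fun c x => by ext k; simp [mul_left_comm] }
    (fun x => by
      have hs := x.summable_sq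
      have h1 : Summable fun k => ‖x (k + 1)‖ ^ 2 := (summable_nat_add_iff 1).mpr hs
      have hle := fun k => weight_sq_le (Real.sqrt_nonneg _) (wt_le_one hq (k + 1)) (x (k + 1))
      have h2 := Summable.of_nonneg_of_le (fun k => by positivity) hle h1
      refine ⟨h2, (h2.tsum_le_tsum hle h1).trans ?_⟩
      rw [hs.tsum_eq_zero_add]
      have : 0 ≤ ‖x 0‖ ^ 2 := by positivity
      linarith)

/-- `π(γ)`: `(π(γ) x)_k = q^k x_k`, i.e. `π(γ) e_n = q^n e_n`. -/
def opγ {q : ℝ} (hq : q ∈ Set.Ioo (0 : ℝ) 1) : Ell2 →L[ℂ] Ell2 :=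
  mkOp
    { toFun := fun x k => ((q ^ k : ℝ) : ℂ) * x k
      map_add' := fun x y => by ext k; simp [mul_add]
      map_smul' := fun c x => by ext k; simp [mul_left_comm] }
    (fun x => by
      have hs := x.summable_sq
      have hle := fun k => weight_sq_le (pow_nonneg hq.1.le k) (pow_le_one₀ hq.1.le hq.2.le) (x k)
      have h2 := Summable.of_nonneg_of_le (fun k => by positivity) hle hs
      exact ⟨h2, h2.tsum_le_tsum hle hs⟩)

/-- `π(δ) = π(α)*`, i.e. `π(δ) e_n = √(1-q^{2n+2}) e_{n+1}`. -/
def opδ {q : ℝ} (hq : q ∈ Set.Ioo (0 : ℝ) 1) : Ell2 →L[ℂ] Ell2 :=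
  ContinuousLinearMap.adjoint (opα hq)

section ops
variable {q : ℝ} (hq : q ∈ Set.Ioo (0 : ℝ) 1) (x : Ell2) (k : ℕ)

theorem opα_apply : opα hq x k = (wt q (k + 1) : ℂ) * x (k + 1) := rfl
theorem opγ_apply : opγ hq x k = ((q ^ k : ℝ) : ℂ) * x k := rfl

theorem e_apply (n : ℕ) : e n k = if k = n then 1 else 0 := by
  by_cases h : k = n <;> simp [e, h, lp.single_apply]

theorem inner_e : inner ℂ (e k) x = x k := by
  rw [e, lp.inner_single_left]
  simp

theorem opα_e_succ (n : ℕ) : opα hq (e (n + 1)) = (wt q (n + 1) : ℂ) • e n := by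
  ext k
  rw [opα_apply, lp.coeFn_smul, Pi.smul_apply, e_apply, e_apply]
  by_cases h : k = n <;> simp [h]

theorem opα_e_zero : opα hq (e 0) = 0 := by
  ext k
  rw [opα_apply, e_apply]
  simp

theorem opγ_e (n : ℕ) : opγ hq (e n) = ((q : ℂ) ^ n) • e n := by
  ext k
  rw [opγ_apply, lp.coeFn_smul, Pi.smul_apply, e_apply]
  by_cases h : k = n <;> simp [h]

theorem opδ_apply_zero : opδ hq x 0 = 0 := by
  rw [← inner_e, opδ, ContinuousLinearMap.adjoint_inner_right, opα_e_zero, inner_zero_left]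

theorem opδ_apply_succ : opδ hq x (k + 1) = (wt q (k + 1) : ℂ) * x k := by
  rw [← inner_e, opδ, ContinuousLinearMap.adjoint_inner_right, opα_e_succ, inner_smul_left,
    inner_e, Complex.conj_ofReal]

/-- `π(γ)` is self-adjoint, so that `π(β) = -q π(γ)* = -q π(γ)` in a `*`-representation. -/
theorem opγ_selfAdjoint : ContinuousLinearMap.adjoint (opγ hq) = opγ hq := by
  ext x k
  rw [← inner_e, ContinuousLinearMap.adjoint_inner_right, opγ_e, inner_smul_left, inner_e,
    opγ_apply]
  simp

end ops

theorem satisfies_op {q : ℝ} (hq : q ∈ Set.Ioo (0 : ℝ) 1) :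
    Satisfies q (opα hq) (-(q : ℂ) • opγ hq) (opγ hq) (opδ hq) := by
  have hq0 : (q : ℂ) ≠ 0 := by exact_mod_cast hq.1.ne'
  have hw : ∀ n, (wt q n : ℂ) * wt q n = 1 - (q : ℂ) ^ (2 * n) := fun n => by
    exact_mod_cast wt_sq hq n
  have cs : ∀ (c : ℂ) (T : Ell2 →L[ℂ] Ell2) (x : Ell2) (k : ℕ), (c • T) x k = c * T x k :=
    fun _ _ _ _ => rfl
  have cm : ∀ (S T : Ell2 →L[ℂ] Ell2) (x : Ell2), (S * T) x = S (T x) := fun _ _ _ => rfl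
  have cd : ∀ (S T : Ell2 →L[ℂ] Ell2) (x : Ell2) (k : ℕ), (S - T) x k = S x k - T x k :=
    fun _ _ _ _ => rfl
  have c1 : ∀ (x : Ell2), (1 : Ell2 →L[ℂ] Ell2) x = x := fun _ => rfl
  constructor <;> (ext x k; rcases k with _ | k)
  all_goals
    simp only [cs, cm, cd, c1, neg_mul, mul_neg, smul_mul_assoc, mul_smul_comm,
      opα_apply, opγ_apply, opδ_apply_zero, opδ_apply_succ, Complex.ofReal_pow]
  · ring
  · ring
  · ring
  · ring
  · ring
  · ring
  · ring
  · ring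
  · linear_combination x 0 * hw (0 + 1)
  · linear_combination x (k + 1) * hw (k + 1 + 1)
  · rw [inv_mul_cancel_left₀ hq0]
    ring
  · rw [inv_mul_cancel_left₀ hq0]
    linear_combination x (k + 1) * hw (k + 1)

/-- The infinite-dimensional irreducible `*`-representation `π` of `A_q(SU(2))` by bounded
operators on `ℓ²(ℤ₊)`: `π(α) e_n = √(1-q^{2n}) e_{n-1}`, `π(γ) e_n = q^n e_n`,
`π(δ) = π(α)*`, `π(β) = -q π(γ)* = -q π(γ)`. -/
def rep {q : ℝ} (hq : q ∈ Set.Ioo (0 : ℝ) 1) : Aq q →ₐ[ℂ] (Ell2 →L[ℂ] Ell2) :=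
  liftAq (satisfies_op hq)

/-- The homomorphism `(π ⊗ τ_θ) ∘ Δ : A_q(SU(2)) → B(ℓ²(ℤ₊)) ⊗ ℂ = B(ℓ²(ℤ₊))`. -/
def repComul {q : ℝ} (hq : q ∈ Set.Ioo (0 : ℝ) 1) (θ : ℝ) : Aq q →ₐ[ℂ] (Ell2 →L[ℂ] Ell2) :=
  ((Algebra.TensorProduct.rid ℂ ℂ (Ell2 →L[ℂ] Ell2)).toAlgHom.comp
    (Algebra.TensorProduct.map (rep hq) (oneDim q θ))).comp (comul hq)

/-! ### The elements `ρ_{τ,σ}` and `ρ_{τ,∞}` -/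

/-- The real power `q^x`, as a complex number. -/
def pw (q x : ℝ) : ℂ := ((q ^ x : ℝ) : ℂ)

/-- `α_{τ,σ} = q^{1/2} α - i q^{σ-1/2} β + i q^{τ+1/2} γ + q^{σ+τ-1/2} δ`. -/
def elα (q τ σ : ℝ) : Aq q :=
  pw q (1 / 2) • gα q - (Complex.I * pw q (σ - 1 / 2)) • gβ q
    + (Complex.I * pw q (τ + 1 / 2)) • gγ q + pw q (σ + τ - 1 / 2) • gδ q

/-- `δ_{τ,σ} = q^{τ+σ+1/2} α + i q^{τ-1/2} β - i q^{σ+1/2} γ + q^{-1/2} δ`. -/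
def elδ (q τ σ : ℝ) : Aq q :=
  pw q (τ + σ + 1 / 2) • gα q + (Complex.I * pw q (τ - 1 / 2)) • gβ q
    - (Complex.I * pw q (σ + 1 / 2)) • gγ q + pw q (-(1 / 2)) • gδ q

/-- `β_{τ,∞} = -i q^{-1/2} β + q^{τ-1/2} δ`. -/
def elβInf (q τ : ℝ) : Aq q :=
  -(Complex.I * pw q (-(1 / 2))) • gβ q + pw q (τ - 1 / 2) • gδ q

/-- `γ_{τ,∞} = -q^{τ+1/2} α + i q^{1/2} γ`. -/
def elγInf (q τ : ℝ) : Aq q :=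
  -(pw q (τ + 1 / 2)) • gα q + (Complex.I * pw q (1 / 2)) • gγ q

/-- `ρ_{τ,σ} = ½ (q^{-τ-σ-1} α_{τ+1,σ+1} δ_{τ,σ} - q^{-τ-σ-1} - q^{τ+σ+1})`. -/
def rho (q τ σ : ℝ) : Aq q :=
  (1 / 2 : ℂ) • (pw q (-τ - σ - 1) • (elα q (τ + 1) (σ + 1) * elδ q τ σ)
    - pw q (-τ - σ - 1) • (1 : Aq q) - pw q (τ + σ + 1) • (1 : Aq q))

/-- `ρ_{τ,∞} = lim_{σ → ∞} 2 q^{σ+τ-1} ρ_{τ,σ} = q^{-1} β_{τ+1,∞} γ_{τ,∞} + q^{2τ}`. -/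
def rhoInf (q τ : ℝ) : Aq q :=
  (q : ℂ)⁻¹ • (elβInf q (τ + 1) * elγInf q τ) + pw q (2 * τ) • (1 : Aq q)

/-! ### The vectors `v_n(q^τ)` and the space `V₁` -/

/-- `w` is the eigenvector `v_lam(q^τ)`: it satisfies `π(ρ_{τ,∞}) w = lam w` and is normalised by
`⟨w, e_0⟩ = 1`. -/
def IsNormalizedEigenvector {q : ℝ} (hq : q ∈ Set.Ioo (0 : ℝ) 1) (τ : ℝ) (lam : ℂ) (w : Ell2) :
    Prop :=
  rep hq (rhoInf q τ) w = lam • w ∧ inner ℂ (e 0) w = 1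

/-- `v` is the sequence `v_n(q^τ) = v_lam(q^τ)` with `lam = -q^{2n}`, `n = 0, 1, 2, …`. -/
def IsEigenSeq {q : ℝ} (hq : q ∈ Set.Ioo (0 : ℝ) 1) (τ : ℝ) (v : ℕ → Ell2) : Prop :=
  ∀ n : ℕ, IsNormalizedEigenvector hq τ (-(q : ℂ) ^ (2 * n)) (v n)

/-- The closed linear span of a sequence of vectors. -/
def closedSpan (v : ℕ → Ell2) : Submodule ℂ Ell2 :=
  (Submodule.span ℂ (Set.range v)).topologicalClosure

theorem mem_closedSpan (v : ℕ → Ell2) (n : ℕ) : v n ∈ closedSpan v :=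
  Submodule.le_topologicalClosure _ (Submodule.subset_span ⟨n, rfl⟩)

/-! ### Al-Salam–Chihara polynomials and their orthogonality measure -/

/-- The `q`-shifted factorial `(a;p)_n = ∏_{j<n} (1 - a p^j)`. -/
def qPoch (a p : ℝ) (n : ℕ) : ℝ := ∏ j ∈ Finset.range n, (1 - a * p ^ j)

/-- The infinite `q`-shifted factorial `(a;p)_∞ = ∏_j (1 - a p^j)`. -/
def qPochInf (a p : ℝ) : ℝ := ∏' j : ℕ, (1 - a * p ^ j)

/-- The Askey–Wilson polynomial
`p_n(x;a,b,c,d|p) = a^{-n} (ab,ac,ad;p)_n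
  ₄φ₃(p^{-n}, abcd p^{n-1}, a e^{iθ}, a e^{-iθ}; ab, ac, ad; p, p)`, `x = cos θ`,
where `(a e^{iθ}, a e^{-iθ}; p)_k = ∏_{j<k} (1 - 2 a x p^j + a² p^{2j})`. -/
def askeyWilson (n : ℕ) (a b c d p x : ℝ) : ℝ :=
  (a ^ n)⁻¹ * (qPoch (a * b) p n * qPoch (a * c) p n * qPoch (a * d) p n) *
    ∑ k ∈ Finset.range (n + 1),
      (qPoch (p ^ n)⁻¹ p k * qPoch (a * b * c * d * p ^ ((n : ℤ) - 1)) p k *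
          ∏ j ∈ Finset.range k, (1 - 2 * a * x * p ^ j + a ^ 2 * p ^ (2 * j))) /
        (qPoch (a * b) p k * qPoch (a * c) p k * qPoch (a * d) p k * qPoch p p k) * p ^ k

/-- The `q`-Jacobi normalisation of the Askey–Wilson polynomials, with `A = p^α` and `B = p^β`:
`p_n^{(α,β)}(x;s,t|p) = p_n(x; p^{1/2} t/s, p^{1/2+α} s/t, -p^{1/2}/(st), -s t p^{1/2+β} | p)`. -/
def qJacobi (n : ℕ) (A B s t p x : ℝ) : ℝ :=
  askeyWilson n (p ^ (1 / 2 : ℝ) * t / s) (p ^ (1 / 2 : ℝ) * A * s / t)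
    (-p ^ (1 / 2 : ℝ) / (s * t)) (-(s * t * p ^ (1 / 2 : ℝ) * B)) p x

/-- The Al-Salam–Chihara polynomials
`h_n(x;s,t|p) = lim_{α,β → ∞} p_n^{(α,β)}(x;s,t|p)`; in the limit `p^α` and `p^β` become `0`, so
these are the Askey–Wilson polynomials with two parameters equal to zero. -/
def alSalamChihara (n : ℕ) (s t p x : ℝ) : ℝ := qJacobi n 0 0 s t p x

/-- The limit relation between the two families of polynomials. -/
theorem tendsto_qJacobi (n : ℕ) {s t p : ℝ} (hs : 0 < s) (ht : 0 < t)
    (hp : p ∈ Set.Ioo (0 : ℝ) 1) (x : ℝ) :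
    Filter.Tendsto (fun z : ℝ × ℝ => qJacobi n (p ^ z.1) (p ^ z.2) s t p x)
      (Filter.atTop ×ˢ Filter.atTop) (nhds (alSalamChihara n s t p x)) := by
  have hpow := tendsto_rpow_atTop_of_base_lt_one p (by linarith [hp.1]) hp.2
  have hz : Filter.Tendsto (fun z : ℝ × ℝ => (p ^ z.1, p ^ z.2)) (Filter.atTop ×ˢ Filter.atTop)
      (nhds ((0 : ℝ), (0 : ℝ))) := by
    rw [nhds_prod_eq]
    exact hpow.prodMap hpow
  have hP : ∀ (k : ℕ) (f : ℝ × ℝ → ℝ), Continuous f → Continuous fun z => qPoch (f z) p k := by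
    intro k f hf
    unfold qPoch
    exact continuous_finsetProd _ fun j _ => by fun_prop
  have hne : ∀ (k : ℕ) (a : ℝ), a < 1 → qPoch a p k ≠ 0 := by
    intro k a ha
    refine Finset.prod_ne_zero_iff.mpr fun j _ => ?_
    have h1 : 0 < p ^ j := pow_pos hp.1 j
    have h2 : p ^ j ≤ 1 := pow_le_one₀ hp.1.le hp.2.le
    have : a * p ^ j < 1 := by
      rcases le_or_gt a 0 with h | h <;> nlinarith
    linarith
  have hcont : ContinuousAt (fun z : ℝ × ℝ => qJacobi n z.1 z.2 s t p x) (0, 0) := by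
    unfold qJacobi askeyWilson
    have hr : 0 < p ^ (1 / 2 : ℝ) := Real.rpow_pos_of_pos hp.1 _
    generalize p ^ (1 / 2 : ℝ) = r at hr ⊢
    have c1 : Continuous fun z : ℝ × ℝ => r * t / s * (r * z.1 * s / t) := by fun_prop
    have c2 : Continuous fun _ : ℝ × ℝ => r * t / s * (-r / (s * t)) := continuous_const
    have c3 : Continuous fun z : ℝ × ℝ => r * t / s * (-(s * t * r * z.2)) := by fun_prop
    have c4 : Continuous fun z : ℝ × ℝ =>
      r * t / s * (r * z.1 * s / t) * (-r / (s * t)) * (-(s * t * r * z.2)) *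
        p ^ ((n : ℤ) - 1) := by fun_prop
    apply ContinuousAt.mul
    · exact (continuous_const.mul (((hP n _ c1).mul (hP n _ c2)).mul (hP n _ c3))).continuousAt
    · apply tendsto_finsetSum
      intro k _
      apply ContinuousAt.mul _ continuousAt_const
      apply ContinuousAt.div
      · exact ((continuous_const.mul (hP k _ c4)).mul continuous_const).continuousAt
      · exact ((((hP k _ c1).mul (hP k _ c2)).mul (hP k _ c3)).mul continuous_const).continuousAt
      · refine mul_ne_zero (mul_ne_zero (mul_ne_zero (hne k _ ?_) (hne k _ ?_)) (hne k _ ?_))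
          (hne k _ hp.2)
        · simp
        · have : 0 < r * t / s * (r / (s * t)) := by positivity
          rw [neg_div, mul_neg]
          linarith
        · simp
  have hlim := Filter.Tendsto.comp hcont.tendsto hz
  simpa only [Function.comp_def, alSalamChihara] using hlim

/-- `m` is an orthogonality measure for the Al-Salam–Chihara polynomials `h_n(·;q^τ,q^σ|q²)`,
normalised by `∫ dm = (-q^{2τ};q²)_∞`: a positive Borel measure on `ℝ` with finite moments, with
respect to which the polynomials are pairwise orthogonal. -/
structure IsOrthMeasure (q τ σ : ℝ) (m : Measure ℝ) : Prop where
  integrable_pow : ∀ n : ℕ, Integrable (fun x : ℝ => x ^ n) m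
  orthogonal : ∀ n k : ℕ, n ≠ k →
    ∫ x, alSalamChihara n (q ^ τ) (q ^ σ) (q ^ 2) x *
      alSalamChihara k (q ^ τ) (q ^ σ) (q ^ 2) x ∂m = 0
  total_mass : m Set.univ = ENNReal.ofReal (qPochInf (-(q ^ (2 * τ))) (q ^ 2))

end QSU2

end

/-!
Write `s = q^τ`, `t = q^σ`. With `P = iγ + sδ`, `Q = sα - iγ = P*`, `X = α + iqsγ` and
`Y = δ - iqsγ = X*`, the operator `A = π(ρ_{τ,∞})` satisfies `PQ = s² - A` and `XY = 1 + q²A`, while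
`QP + YX = s² + 1`. Hence `R = PY` raises the eigenvalues of `A`, that is `A R = q² R A`, and its
adjoint `R* = XQ` lowers them (`opA_mul_opRaise`, `opLower_mul_opA`). Moreover
`T = (π ⊗ τ_{φ/2}) Δ(ρ_{τ,σ})` is
`(2s)⁻¹ (e^{-iφ} R + e^{iφ} R* + q (t⁻¹ - t) A)` (`repComul_rho`).

The equation `A x = λ x` is a three-term recurrence in the coordinates of `x`, so eigenvectors are
determined by their coordinate at `e 0` (`eq_zero_of_opA_eq_smul`). For `λ = -1` the solution is
explicit, its norm is given by Euler's product for `(-q^{2τ}; q²)_∞` (`tsum_eulerTerm`), and the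
raising operator produces the remaining `v_n`. Comparing coordinates at `e 0`, `R v_n = q s v_{n+1}`
and `R* v_n = (s/q) (1 - q^{2n}) (1 + q^{2n}/s²) v_{n-1}`. So `T` acts on the `v_n` by the
three-term recurrence of the `h_n` (`chihara_recurrence`, read off from the basic hypergeometric sum by
comparing coefficients), up to the factors `q^{-n} e^{inφ}`.

Consequently `h_n(T) v_0` is a multiple of `v_n` (`aeval_chiharaPoly`), and the spectral measure of
the self-adjoint operator `T` (for `φ = 0`) at `v_0` is an orthogonality measure. Any orthogonality
measure has the same moments, since the `h_n` span the polynomials. These moments are `O(‖T‖ⁿ)`, so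
the measure lives on a bounded interval (`ae_abs_le_of_moments`), and Weierstrass' theorem gives
uniqueness and the density of polynomials in `L²(dm)`. Finally `v_n` and `q^{-n} e^{inφ} h_n` are
orthogonal systems with dense span whose squared norms start at `(-q^{2τ}; q²)_∞` and obey the same
recursion, so they are matched by a unitary operator, which intertwines `T` and `M` on the `v_n`.
-/

namespace QSU2

/-! ### The three-term recurrence of the Al-Salam–Chihara polynomials -/

theorem qPoch_succ (a p : ℝ) (n : ℕ) : qPoch a p (n + 1) = qPoch a p n * (1 - a * p ^ n) :=
  Finset.prod_range_succ _ _

theorem qPoch_succ_left (a p : ℝ) (n : ℕ) : qPoch a p (n + 1) = (1 - a) * qPoch (a * p) p n := by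
  simp only [qPoch, Finset.prod_range_succ', pow_zero, mul_one]
  rw [mul_comm]
  congr 1
  refine Finset.prod_congr rfl fun j _ => ?_
  ring

/-- The `(p^{-n}; p)_k` terminate: they vanish for `k > n`. -/
theorem qPoch_inv_pow_eq_zero {p : ℝ} (hp : p ≠ 0) {n k : ℕ} (h : n < k) :
    qPoch (p ^ n)⁻¹ p k = 0 :=
  Finset.prod_eq_zero (Finset.mem_range.mpr h) (by
    rw [inv_mul_cancel₀ (pow_ne_zero n hp), sub_self])

/-- The product `(a e^{iθ}, a e^{-iθ}; p)_k` as a polynomial in `x = cos θ`. -/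
noncomputable def askeyBasis (a p x : ℝ) (k : ℕ) : ℝ :=
  ∏ j ∈ Finset.range k, (1 - 2 * a * x * p ^ j + a ^ 2 * p ^ (2 * j))

/-- The coefficient of `askeyBasis a p x k` in the Al-Salam–Chihara polynomial of degree `n` with
parameters `a` and `c`. -/
noncomputable def chiharaCoeff (a c p : ℝ) (n k : ℕ) : ℝ :=
  (a ^ n)⁻¹ * qPoch (a * c) p n *
    (qPoch (p ^ n)⁻¹ p k / (qPoch (a * c) p k * qPoch p p k) * p ^ k)

theorem askeyWilson_eq_sum {p : ℝ} (hp : p ≠ 0) (a c x : ℝ) {n N : ℕ} (h : n < N) :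
    askeyWilson n a 0 c 0 p x =
      ∑ k ∈ Finset.range N, chiharaCoeff a c p n k * askeyBasis a p x k := by
  have h0 : ∀ k, qPoch 0 p k = 1 := fun k => by simp [qPoch]
  rw [← Finset.sum_subset (Finset.range_mono (Nat.succ_le_of_lt h))]
  · simp only [askeyWilson, mul_zero, zero_mul, h0, mul_one, one_mul, Finset.mul_sum, chiharaCoeff,
      askeyBasis]
    refine Finset.sum_congr rfl fun k _ => ?_
    ring
  · intro k _ hk
    rw [Finset.mem_range, not_lt] at hk
    simp [chiharaCoeff, qPoch_inv_pow_eq_zero hp hk]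

section recurrence
variable {a c p : ℝ} (ha : a ≠ 0) (hp : p ≠ 0) (hac : ∀ k, 1 - a * c * p ^ k ≠ 0)
  (hpp : ∀ k, 1 - p * p ^ k ≠ 0)
include ha hp

/-- Multiplication by `2x` in the basis `askeyBasis`. -/
theorem askeyBasis_mul (x : ℝ) (k : ℕ) : 2 * x * askeyBasis a p x k =
    (1 / (a * p ^ k) + a * p ^ k) * askeyBasis a p x k
      - 1 / (a * p ^ k) * askeyBasis a p x (k + 1) := by
  have : p ^ k ≠ 0 := pow_ne_zero k hp
  simp only [askeyBasis, Finset.prod_range_succ]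
  field_simp
  ring

include hac

/-- The three-term recurrence at the constant term. -/
theorem chiharaCoeff_zero (n : ℕ) : (1 / a + a) * chiharaCoeff a c p n 0 =
    chiharaCoeff a c p (n + 1) 0 + (a + c) * p ^ n * chiharaCoeff a c p n 0
      + (1 - p ^ n) * (1 - a * c * p ^ n / p) * chiharaCoeff a c p (n - 1) 0 := by
  have hn : ∀ b, qPoch b p 0 = 1 := fun b => by simp [qPoch]
  rcases n with _ | n
  · simp only [chiharaCoeff, hn, qPoch_succ]
    field_simp
    ring
  · have := hac n
    simp only [chiharaCoeff, hn, qPoch_succ, Nat.add_sub_cancel, pow_succ]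
    field_simp
    ring

include hpp

/-- The three-term recurrence at the coefficient of `askeyBasis a p x (j + 1)`. All three
terminating factors `(p^{-n-1}; p)_{j+1}`, `(p^{-n}; p)_{j+1}`, `(p^{-n+1}; p)_{j+1}` are expressed
through `(p^{-n}; p)_j`. -/
theorem chiharaCoeff_succ (n j : ℕ) :
    (1 / (a * p ^ (j + 1)) + a * p ^ (j + 1)) * chiharaCoeff a c p n (j + 1)
      - 1 / (a * p ^ j) * chiharaCoeff a c p n j =
    chiharaCoeff a c p (n + 1) (j + 1) + (a + c) * p ^ n * chiharaCoeff a c p n (j + 1)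
      + (1 - p ^ n) * (1 - a * c * p ^ n / p) * chiharaCoeff a c p (n - 1) (j + 1) := by
  have hne : qPoch (a * c) p j ≠ 0 := Finset.prod_ne_zero_iff.mpr fun k _ => hac k
  have hne' : qPoch p p j ≠ 0 := Finset.prod_ne_zero_iff.mpr fun k _ => hpp k
  have hpn : ∀ m, p ^ m ≠ 0 := fun m => pow_ne_zero m hp
  have h1 := hac j
  have h2 := hpp j
  have hup : ∀ m, qPoch (p ^ (m + 1))⁻¹ p (j + 1) =
      (1 - (p ^ (m + 1))⁻¹) * qPoch (p ^ m)⁻¹ p j := by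
    intro m
    rw [qPoch_succ_left]
    congr 2
    rw [pow_succ]
    field_simp
  rcases n with _ | n
  · have hz : qPoch (p ^ 0)⁻¹ p j * (1 - p ^ j) = 0 := by
      have := qPoch_inv_pow_eq_zero hp (Nat.succ_pos j)
      rw [qPoch_succ] at this
      simpa using this
    simp only [chiharaCoeff, hup, qPoch_succ]
    have := hpn j
    generalize qPoch (p ^ 0)⁻¹ p j = G at *
    simp only [pow_succ, pow_zero, inv_one, one_mul, mul_one] at *
    generalize p ^ j = w at *
    generalize hD : 1 - a * c * w = D at *
    generalize hE : 1 - p * w = E at *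
    have h0 : qPoch (a * c) p 0 = 1 := by simp [qPoch]
    rw [h0]
    field_simp
    subst hD hE
    linear_combination (a ^ 2 * w * p * (p * w - 1)) * hz
  · have hdown : (1 - (p ^ (n + 1))⁻¹) * qPoch (p ^ n)⁻¹ p (j + 1) =
        qPoch (p ^ (n + 1))⁻¹ p j * (1 - (p ^ (n + 1))⁻¹ * p ^ j)
          * (1 - (p ^ (n + 1))⁻¹ * p ^ (j + 1)) := by
      rw [← qPoch_succ, ← qPoch_succ, qPoch_succ_left _ _ (j + 1)]
      congr 2
      rw [pow_succ]
      field_simp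
    have hd : chiharaCoeff a c p n (j + 1) * (1 - (p ^ (n + 1))⁻¹) = (a ^ n)⁻¹ * qPoch (a * c) p n *
      (qPoch (p ^ (n + 1))⁻¹ p j * (1 - (p ^ (n + 1))⁻¹ * p ^ j)
          * (1 - (p ^ (n + 1))⁻¹ * p ^ (j + 1)) /
          (qPoch (a * c) p (j + 1) * qPoch p p (j + 1)) * p ^ (j + 1)) := by
      rw [← hdown, chiharaCoeff]
      ring
    have hC : (1 - p ^ (n + 1)) * (1 - a * c * p ^ (n + 1) / p) * chiharaCoeff a c p n (j + 1) =
        - p ^ (n + 1) * (1 - a * c * p ^ (n + 1) / p) *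
          (chiharaCoeff a c p n (j + 1) * (1 - (p ^ (n + 1))⁻¹)) := by
      have := hpn (n + 1)
      field_simp
      ring
    rw [Nat.add_sub_cancel, hC, hd]
    simp only [chiharaCoeff, hup (n + 1)]
    simp only [qPoch_succ]
    generalize qPoch (p ^ (n + 1))⁻¹ p j = G
    have := hpn n
    have := hpn j
    have := hac n
    have := pow_ne_zero n ha
    simp only [pow_succ] at *
    generalize p ^ n = u at *
    generalize p ^ j = w at *
    generalize a ^ n = z at *
    generalize hD : 1 - a * c * w = D at *
    generalize hE : 1 - p * w = E at *
    field_simp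
    subst hD hE
    ring

/-- The three-term recurrence of the Al-Salam–Chihara polynomials. For `n = 0` the last term
vanishes, so the truncated index `n - 1` is harmless. -/
theorem askeyWilson_recurrence (x : ℝ) (n : ℕ) : 2 * x * askeyWilson n a 0 c 0 p x =
    askeyWilson (n + 1) a 0 c 0 p x + (a + c) * p ^ n * askeyWilson n a 0 c 0 p x
      + (1 - p ^ n) * (1 - a * c * p ^ n / p) * askeyWilson (n - 1) a 0 c 0 p x := by
  rw [askeyWilson_eq_sum hp a c x (show n < n + 2 by omega),
    askeyWilson_eq_sum hp a c x (show n + 1 < n + 2 by omega),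
    askeyWilson_eq_sum hp a c x (show n - 1 < n + 2 by omega)]
  have hshift : ∑ k ∈ Finset.range (n + 2),
        chiharaCoeff a c p n k * (1 / (a * p ^ k) * askeyBasis a p x (k + 1)) =
      ∑ k ∈ Finset.range (n + 1),
        chiharaCoeff a c p n k * (1 / (a * p ^ k) * askeyBasis a p x (k + 1)) := by
    rw [Finset.sum_range_succ]
    simp [chiharaCoeff, qPoch_inv_pow_eq_zero hp (Nat.lt_succ_self n)]
  have hL : 2 * x * ∑ k ∈ Finset.range (n + 2), chiharaCoeff a c p n k * askeyBasis a p x k =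
      ∑ k ∈ Finset.range (n + 2),
        (1 / (a * p ^ k) + a * p ^ k) * chiharaCoeff a c p n k * askeyBasis a p x k
      - ∑ k ∈ Finset.range (n + 2),
        chiharaCoeff a c p n k * (1 / (a * p ^ k) * askeyBasis a p x (k + 1)) := by
    rw [Finset.mul_sum, ← Finset.sum_sub_distrib]
    refine Finset.sum_congr rfl fun k _ => ?_
    linear_combination chiharaCoeff a c p n k * askeyBasis_mul ha hp x k
  rw [hL, hshift]
  simp only [Finset.mul_sum]
  simp only [Finset.sum_range_succ' _ (n + 1)]
  have h0 := chiharaCoeff_zero ha hp hac n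
  have hs : ∑ k ∈ Finset.range (n + 1), (1 / (a * p ^ (k + 1)) + a * p ^ (k + 1)) *
        chiharaCoeff a c p n (k + 1) * askeyBasis a p x (k + 1)
      - ∑ k ∈ Finset.range (n + 1),
        chiharaCoeff a c p n k * (1 / (a * p ^ k) * askeyBasis a p x (k + 1)) =
      ∑ k ∈ Finset.range (n + 1), chiharaCoeff a c p (n + 1) (k + 1) * askeyBasis a p x (k + 1)
      + ∑ k ∈ Finset.range (n + 1),
        (a + c) * p ^ n * (chiharaCoeff a c p n (k + 1) * askeyBasis a p x (k + 1))
      + ∑ k ∈ Finset.range (n + 1), (1 - p ^ n) * (1 - a * c * p ^ n / p) *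
        (chiharaCoeff a c p (n - 1) (k + 1) * askeyBasis a p x (k + 1)) := by
    rw [← Finset.sum_sub_distrib, ← Finset.sum_add_distrib, ← Finset.sum_add_distrib]
    refine Finset.sum_congr rfl fun k _ => ?_
    linear_combination askeyBasis a p x (k + 1) * chiharaCoeff_succ ha hp hac hpp n k
  simp only [pow_zero, mul_one]
  linear_combination hs + askeyBasis a p x 0 * h0

end recurrence

/-- The recurrence coefficient `(1 - q^{2n})(1 + q^{2n-2τ})` of the polynomials `h_n`. -/
noncomputable def recCoeff (q τ : ℝ) (n : ℕ) : ℝ :=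
  (1 - q ^ (2 * n)) * (1 + q ^ (2 * n) / (q ^ τ) ^ 2)

/-- The polynomials `h_n(·; q^τ, q^σ | q²)`. -/
noncomputable def chihara (q τ σ : ℝ) (n : ℕ) (x : ℝ) : ℝ :=
  alSalamChihara n (q ^ τ) (q ^ σ) (q ^ 2) x

theorem chihara_zero (q τ σ x : ℝ) : chihara q τ σ 0 x = 1 := by
  simp [chihara, alSalamChihara, qJacobi, askeyWilson, qPoch]

theorem chihara_recurrence {q : ℝ} (hq : q ∈ Set.Ioo (0 : ℝ) 1) (τ σ x : ℝ) (n : ℕ) :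
    2 * x * chihara q τ σ n x = chihara q τ σ (n + 1) x
      + q / q ^ τ * (q ^ σ - (q ^ σ)⁻¹) * q ^ (2 * n) * chihara q τ σ n x
      + recCoeff q τ n * chihara q τ σ (n - 1) x := by
  have hs : 0 < q ^ τ := Real.rpow_pos_of_pos hq.1 _
  have ht : 0 < q ^ σ := Real.rpow_pos_of_pos hq.1 _
  have hr : (q ^ 2 : ℝ) ^ (1 / 2 : ℝ) = q := by
    rw [← Real.sqrt_eq_rpow, Real.sqrt_sq hq.1.le]
  have hq0 := hq.1
  have hac : q * q ^ σ / q ^ τ * (-q / (q ^ τ * q ^ σ)) = -(q ^ 2 / (q ^ τ) ^ 2) := by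
    field_simp
  have key := askeyWilson_recurrence (a := q * q ^ σ / q ^ τ) (c := -q / (q ^ τ * q ^ σ))
    (p := q ^ 2) (by positivity) (by positivity) (fun k => by
      rw [hac]
      have : 0 < q ^ 2 / (q ^ τ) ^ 2 * (q ^ 2) ^ k := by positivity
      linarith) (fun k => by
      have : q ^ 2 * (q ^ 2) ^ k < 1 := by
        rw [← pow_mul, ← pow_add]
        exact pow_lt_one₀ hq.1.le hq.2 (by omega)
      linarith) x n
  rw [hac] at key
  simp only [chihara, alSalamChihara, qJacobi, hr, mul_zero, zero_mul, zero_div, neg_zero, recCoeff]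
  rw [key, pow_mul]
  field_simp
  ring

/-! ### Euler's product for `(-z; p)_∞` -/

section euler
variable {p : ℝ} (hp : p ∈ Set.Ioo (0 : ℝ) 1)

/-- The term `z^k p^{k(k-1)/2} / (p;p)_k` of Euler's series for `(-z; p)_∞`. -/
noncomputable def eulerTerm (p z : ℝ) (k : ℕ) : ℝ :=
  ∏ j ∈ Finset.range k, (z * p ^ j / (1 - p ^ (j + 1)))

include hp

theorem one_sub_pow_pos (j : ℕ) : 0 < 1 - p ^ (j + 1) := by
  have := pow_lt_one₀ hp.1.le hp.2 (Nat.succ_ne_zero j)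
  simp only [Nat.succ_eq_add_one] at this
  linarith

theorem eulerTerm_pos {z : ℝ} (hz : 0 < z) (k : ℕ) : 0 < eulerTerm p z k :=
  Finset.prod_pos fun j _ => div_pos (mul_pos hz (pow_pos hp.1 j)) (one_sub_pow_pos hp j)

theorem summable_eulerTerm {z : ℝ} (hz : 0 < z) : Summable (eulerTerm p z) := by
  refine summable_of_ratio_test_tendsto_lt_one (l := 0) one_pos
    (.of_forall fun k => (eulerTerm_pos hp hz k).ne') ?_
  have h : ∀ k, ‖eulerTerm p z (k + 1)‖ / ‖eulerTerm p z k‖ = z * p ^ k / (1 - p ^ (k + 1)) := by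
    intro k
    rw [Real.norm_of_nonneg (eulerTerm_pos hp hz _).le,
      Real.norm_of_nonneg (eulerTerm_pos hp hz _).le, div_eq_iff (eulerTerm_pos hp hz _).ne',
      eulerTerm, Finset.prod_range_succ, mul_comm, eulerTerm]
  simp only [h]
  have h0 := tendsto_pow_atTop_nhds_zero_of_lt_one hp.1.le hp.2
  have h1 := (h0.comp (Filter.tendsto_add_atTop_nat 1)).const_sub 1
  have := (h0.const_mul z).div h1 (by norm_num)
  simpa [Pi.div_def] using this

omit hp in
theorem eulerTerm_mul_pow (z w : ℝ) (k : ℕ) : eulerTerm p (z * w) k = eulerTerm p z k * w ^ k := by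
  induction k with
  | zero => simp [eulerTerm]
  | succ k ih =>
    simp only [eulerTerm, Finset.prod_range_succ] at ih ⊢
    rw [ih]
    ring

/-- The functional equation `F(z) = (1 + z) F(pz)` of Euler's series. -/
theorem tsum_eulerTerm_eq {z : ℝ} (hz : 0 < z) :
    ∑' k, eulerTerm p z k = (1 + z) * ∑' k, eulerTerm p (z * p) k := by
  have hs := summable_eulerTerm hp hz
  have hs' := summable_eulerTerm hp (mul_pos hz hp.1)
  have hstep : ∀ k, eulerTerm p z (k + 1) =
      eulerTerm p (z * p) (k + 1) + z * eulerTerm p (z * p) k := by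
    intro k
    rw [eulerTerm_mul_pow, eulerTerm_mul_pow]
    have := (one_sub_pow_pos hp k).ne'
    simp only [eulerTerm, Finset.prod_range_succ]
    field_simp
    ring
  rw [hs.tsum_eq_zero_add, tsum_congr hstep,
    ((summable_nat_add_iff 1).mpr hs').tsum_add (hs'.mul_left z), tsum_mul_left, one_add_mul,
    hs'.tsum_eq_zero_add]
  simp [eulerTerm]
  ring

/-- Euler's identity `∑_k z^k p^{k(k-1)/2} / (p;p)_k = (-z; p)_∞`: iterate the functional equation
`F(z) = (1 + z) F(pz)`. -/
theorem tsum_eulerTerm {z : ℝ} (hz : 0 < z) : ∑' k, eulerTerm p z k = qPochInf (-z) p := by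
  have hiter : ∀ n : ℕ, ∑' k, eulerTerm p z k =
      (∏ j ∈ Finset.range n, (1 + z * p ^ j)) * ∑' k, eulerTerm p (z * p ^ n) k := by
    intro n
    induction n with
    | zero => simp
    | succ n ih =>
      rw [ih, tsum_eulerTerm_eq hp (mul_pos hz (pow_pos hp.1 n)), Finset.prod_range_succ, pow_succ]
      ring_nf
  have h0 := tendsto_pow_atTop_nhds_zero_of_lt_one hp.1.le hp.2
  have htail : Filter.Tendsto (fun n : ℕ => ∑' k, eulerTerm p (z * p ^ n) k) Filter.atTop
      (nhds 1) := by
    have hs := summable_eulerTerm hp hz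
    have hs1 := (summable_nat_add_iff 1).mpr hs
    refine tendsto_of_tendsto_of_tendsto_of_le_of_le (g := fun _ => (1 : ℝ))
      (h := fun n : ℕ => 1 + (∑' k, eulerTerm p z (k + 1)) * p ^ n) tendsto_const_nhds
      (by simpa using (h0.const_mul _).const_add (1 : ℝ)) ?_ ?_
    · intro n
      have hsn := summable_eulerTerm hp (mul_pos hz (pow_pos hp.1 n))
      have := hsn.le_tsum 0 fun k _ => (eulerTerm_pos hp (mul_pos hz (pow_pos hp.1 n)) k).le
      simpa [eulerTerm] using this
    · intro n
      have hsn := summable_eulerTerm hp (mul_pos hz (pow_pos hp.1 n))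
      simp only
      rw [hsn.tsum_eq_zero_add, ← tsum_mul_right]
      refine add_le_add (by simp [eulerTerm]) ?_
      refine ((summable_nat_add_iff 1).mpr hsn).tsum_le_tsum (fun k => ?_) (hs1.mul_right _)
      rw [eulerTerm_mul_pow, ← pow_mul]
      exact mul_le_mul_of_nonneg_left
        (pow_le_pow_of_le_one hp.1.le hp.2.le (Nat.le_mul_of_pos_right n k.succ_pos))
        (eulerTerm_pos hp hz _).le
  have hmul : Multipliable fun j : ℕ => 1 - (-z) * p ^ j := by
    have : Summable fun j : ℕ => z * p ^ j :=
      (summable_geometric_of_lt_one hp.1.le hp.2).mul_left z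
    simpa using Real.multipliable_one_add_of_summable this
  have hlim := hmul.hasProd.tendsto_prod_nat.mul htail
  have hconst : (fun n : ℕ => (∏ j ∈ Finset.range n, (1 - (-z) * p ^ j)) *
      ∑' k, eulerTerm p (z * p ^ n) k) = fun _ => ∑' k, eulerTerm p z k := by
    funext n
    rw [hiter n]
    simp
  rw [hconst, mul_one] at hlim
  exact tendsto_nhds_unique tendsto_const_nhds hlim

end euler

/-! ### The operators -/

section operators
variable {q : ℝ} (hq : q ∈ Set.Ioo (0 : ℝ) 1) (s : ℝ)

theorem opα_mul_opγ : opα hq * opγ hq = (q : ℂ) • (opγ hq * opα hq) := (satisfies_op hq).ac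

theorem opγ_mul_opδ : opγ hq * opδ hq = (q : ℂ) • (opδ hq * opγ hq) := (satisfies_op hq).cd

theorem opα_mul_opδ : opα hq * opδ hq = 1 - (q : ℂ) ^ 2 • (opγ hq * opγ hq) := by
  rw [← (satisfies_op hq).ad, smul_mul_assoc, smul_smul]
  module

theorem opδ_mul_opα : opδ hq * opα hq = 1 - opγ hq * opγ hq := by
  have hq0 : (q : ℂ) ≠ 0 := by exact_mod_cast hq.1.ne'
  rw [← (satisfies_op hq).da, smul_mul_assoc, smul_smul, mul_neg, inv_mul_cancel₀ hq0]
  module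

/-- The operator `iγ + sδ`. -/
noncomputable def opP : Ell2 →L[ℂ] Ell2 := Complex.I • opγ hq + (s : ℂ) • opδ hq

/-- The operator `sα - iγ`, the adjoint of `opP`. -/
noncomputable def opQ : Ell2 →L[ℂ] Ell2 := (s : ℂ) • opα hq - Complex.I • opγ hq

/-- The operator `α + iqsγ`. -/
noncomputable def opX : Ell2 →L[ℂ] Ell2 := opα hq + (Complex.I * q * s) • opγ hq

/-- The operator `δ - iqsγ`, the adjoint of `opX`. -/
noncomputable def opY : Ell2 →L[ℂ] Ell2 := opδ hq - (Complex.I * q * s) • opγ hq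

/-- The operator `π(ρ_{τ,∞})` for `s = q^τ`. -/
noncomputable def opA : Ell2 →L[ℂ] Ell2 := (s : ℂ) ^ 2 • 1 - opP hq s * opQ hq s

/-- The raising operator: it multiplies the eigenvalues of `opA` by `q²`. -/
noncomputable def opRaise : Ell2 →L[ℂ] Ell2 := opP hq s * opY hq s

/-- The lowering operator, the adjoint of `opRaise`. -/
noncomputable def opLower : Ell2 →L[ℂ] Ell2 := opX hq s * opQ hq s

theorem opX_mul_opY : opX hq s * opY hq s = 1 + (q : ℂ) ^ 2 • opA hq s := by
  simp only [opX, opY, opA, opP, opQ, add_mul, mul_sub, smul_mul_assoc,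
    mul_smul_comm, opα_mul_opδ, opα_mul_opγ, opγ_mul_opδ, opδ_mul_opα]
  match_scalars <;>
    first
    | ring1
    | linear_combination (-(q : ℂ) ^ 2 * (1 + s ^ 2)) * Complex.I_sq

/-- `opQ * opP` and `opY * opX` are both affine in `π(ρ_{τ+1,∞})`, with opposite linear parts. -/
theorem opQ_mul_opP_add : opQ hq s * opP hq s = ((s : ℂ) ^ 2 + 1) • 1 - opY hq s * opX hq s := by
  simp only [opX, opY, opP, opQ, mul_add, sub_mul, smul_mul_assoc,
    mul_smul_comm, opα_mul_opδ, opα_mul_opγ, opγ_mul_opδ, opδ_mul_opα]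
  match_scalars <;>
    first
    | ring1
    | linear_combination (-1 - (s : ℂ) ^ 2 * q ^ 2) * Complex.I_sq

/-- `ρ_{τ,∞}` and the raising operator `q²`-commute. -/
theorem opA_mul_opRaise : opA hq s * opRaise hq s = (q : ℂ) ^ 2 • (opRaise hq s * opA hq s) := by
  have h1 : opA hq s * opRaise hq s =
      opP hq s * ((s : ℂ) ^ 2 • 1 - opQ hq s * opP hq s) * opY hq s := by
    simp only [opA, opRaise]
    noncomm_ring
  have h2 : ((s : ℂ) ^ 2 • 1 - opQ hq s * opP hq s) = opY hq s * opX hq s - 1 := by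
    rw [opQ_mul_opP_add]
    module
  have h3 : opP hq s * (opY hq s * opX hq s - 1) * opY hq s =
      opP hq s * opY hq s * (opX hq s * opY hq s - 1) := by
    noncomm_ring
  rw [h1, h2, h3, opX_mul_opY, opRaise, add_sub_cancel_left, mul_smul_comm]

theorem adjoint_opδ : ContinuousLinearMap.adjoint (opδ hq) = opα hq := by
  rw [opδ, ContinuousLinearMap.adjoint_adjoint]

theorem adjoint_opP : ContinuousLinearMap.adjoint (opP hq s) = opQ hq s := by
  simp only [opP, opQ, map_add, map_smulₛₗ, adjoint_opδ, opγ_selfAdjoint, Complex.conj_I,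
    Complex.conj_ofReal]
  module

theorem adjoint_opQ : ContinuousLinearMap.adjoint (opQ hq s) = opP hq s := by
  rw [← adjoint_opP, ContinuousLinearMap.adjoint_adjoint]

theorem adjoint_opX : ContinuousLinearMap.adjoint (opX hq s) = opY hq s := by
  rw [opX, opY, map_add, map_smulₛₗ, opγ_selfAdjoint, ← opδ]
  simp only [map_mul, Complex.conj_I, Complex.conj_ofReal]
  module

theorem adjoint_opA : ContinuousLinearMap.adjoint (opA hq s) = opA hq s := by
  rw [opA, map_sub, map_smulₛₗ, ContinuousLinearMap.mul_def, ContinuousLinearMap.adjoint_comp,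
    adjoint_opP, adjoint_opQ, map_pow, Complex.conj_ofReal]
  congr 2
  exact ContinuousLinearMap.adjoint_id

theorem adjoint_opLower : ContinuousLinearMap.adjoint (opLower hq s) = opRaise hq s := by
  rw [opLower, ContinuousLinearMap.mul_def, ContinuousLinearMap.adjoint_comp,
    adjoint_opX, adjoint_opQ]
  rfl

theorem adjoint_opRaise : ContinuousLinearMap.adjoint (opRaise hq s) = opLower hq s := by
  rw [← adjoint_opLower, ContinuousLinearMap.adjoint_adjoint]

theorem opLower_mul_opA : opLower hq s * opA hq s = (q : ℂ) ^ 2 • (opA hq s * opLower hq s) := by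
  have h := congrArg ContinuousLinearMap.adjoint (opA_mul_opRaise hq s)
  simpa only [map_smulₛₗ, ContinuousLinearMap.mul_def, ContinuousLinearMap.adjoint_comp,
    adjoint_opA, adjoint_opRaise, map_pow, Complex.conj_ofReal] using h

end operators

/-! ### The images of `ρ_{τ,∞}` and `ρ_{τ,σ}` -/

section images
variable {q : ℝ} (hq : q ∈ Set.Ioo (0 : ℝ) 1)

include hq in
theorem pw_add (x y : ℝ) : pw q (x + y) = pw q x * pw q y := by
  simp [pw, Real.rpow_add hq.1]

include hq in
theorem pw_sub (x y : ℝ) : pw q (x - y) = pw q x * (pw q y)⁻¹ := by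
  simp [pw, Real.rpow_sub hq.1, div_eq_mul_inv]

include hq in
theorem pw_neg (x : ℝ) : pw q (-x) = (pw q x)⁻¹ := by
  simp [pw, Real.rpow_neg hq.1.le]

theorem pw_one (q : ℝ) : pw q 1 = q := by simp [pw]

include hq in
theorem pw_half_sq : pw q (1 / 2) ^ 2 = q := by
  rw [sq, ← pw_add hq, add_halves, pw_one]

include hq in
theorem pw_two_mul (x : ℝ) : pw q (2 * x) = pw q x ^ 2 := by
  rw [two_mul, pw_add hq, sq]

include hq in
theorem pw_ne_zero (x : ℝ) : pw q x ≠ 0 := by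
  simpa [pw] using (Real.rpow_pos_of_pos hq.1 x).ne'

theorem rep_rhoInf (τ : ℝ) : rep hq (rhoInf q τ) = opA hq (q ^ τ) := by
  have hr := pw_half_sq hq
  have hr0 := pw_ne_zero hq (1 / 2)
  have hs : ((q ^ τ : ℝ) : ℂ) = pw q τ := rfl
  have hq0 : (q : ℂ) ≠ 0 := by exact_mod_cast hq.1.ne'
  simp only [rhoInf, elβInf, elγInf, map_add, map_smul, map_mul, map_one, rep, liftAq_gα,
    liftAq_gβ, liftAq_gγ, liftAq_gδ, opA, opP, opQ, pw_add hq, pw_sub hq, pw_neg hq, pw_one,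
    pw_two_mul hq, hs]
  generalize pw q (1 / 2) = r at *
  generalize pw q τ = t
  simp only [← hr] at *
  simp only [add_mul, mul_add, mul_sub, smul_mul_assoc, mul_smul_comm, opδ_mul_opα]
  match_scalars <;> field_simp <;> ring1

-- `τ_θ` kills `β` and `γ`, so only one summand of each `Δ(x)` survives under `π ⊗ τ_θ`.
theorem repComul_gα (θ : ℝ) :
    repComul hq θ (gα q) = Complex.exp (Complex.I * θ) • opα hq := by
  simp [repComul, comul, liftAq_gα, rep, oneDim, liftAq_gγ, liftAq_gβ]

theorem repComul_gβ (θ : ℝ) :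
    repComul hq θ (gβ q) = -(Complex.exp (-(Complex.I * θ)) * q) • opγ hq := by
  rw [neg_smul, mul_smul, ← smul_neg, ← neg_smul]
  simp [repComul, comul, liftAq_gα, rep, oneDim, liftAq_gβ, liftAq_gδ]

theorem repComul_gγ (θ : ℝ) :
    repComul hq θ (gγ q) = Complex.exp (Complex.I * θ) • opγ hq := by
  simp [repComul, comul, liftAq_gα, rep, oneDim, liftAq_gγ, liftAq_gδ]

theorem repComul_gδ (θ : ℝ) :
    repComul hq θ (gδ q) = Complex.exp (-(Complex.I * θ)) • opδ hq := by
  simp [repComul, comul, rep, oneDim, liftAq_gγ, liftAq_gβ, liftAq_gδ]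

/-- The operator `(π ⊗ τ_{φ/2}) Δ(ρ_{τ,σ})` as a combination of the raising, the lowering and the
diagonal operator. -/
theorem repComul_rho (τ σ φ : ℝ) : repComul hq (φ / 2) (rho q τ σ) =
    (2 * (q ^ τ : ℝ) : ℂ)⁻¹ • (Complex.exp (-(Complex.I * φ)) • opRaise hq (q ^ τ)
      + Complex.exp (Complex.I * φ) • opLower hq (q ^ τ)
      + ((q * ((q ^ σ)⁻¹ - q ^ σ) : ℝ) : ℂ) • opA hq (q ^ τ)) := by
  have hr := pw_half_sq hq
  have hr0 := pw_ne_zero hq (1 / 2)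
  have ht0 := pw_ne_zero hq σ
  have hs0 := pw_ne_zero hq τ
  have hq0 : (q : ℂ) ≠ 0 := by exact_mod_cast hq.1.ne'
  have hu : Complex.exp (Complex.I * φ) = Complex.exp (Complex.I * (φ / 2 : ℝ)) ^ 2 := by
    rw [← Complex.exp_nat_mul]
    congr 1
    push_cast
    ring
  have hu0 := Complex.exp_ne_zero (Complex.I * (φ / 2 : ℝ))
  have hs : ((q ^ τ : ℝ) : ℂ) = pw q τ := rfl
  have ht : ((q ^ σ : ℝ) : ℂ) = pw q σ := rfl
  simp only [Complex.exp_neg, hu, rho, elα, elδ, map_add, map_smul, map_mul, map_one, map_sub,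
    repComul_gα, repComul_gβ, repComul_gγ, repComul_gδ, opA, opRaise, opLower, opX, opY, opP, opQ,
    pw_add hq, pw_sub hq, pw_neg hq, pw_one, hs, ht, Complex.ofReal_mul,
    Complex.ofReal_sub, Complex.ofReal_inv]
  generalize pw q (1 / 2) = r at *
  generalize pw q τ = t at *
  generalize pw q σ = w at *
  generalize Complex.exp (Complex.I * (φ / 2 : ℝ)) = u at *
  simp only [add_mul, mul_add, sub_mul, mul_sub, smul_mul_assoc, mul_smul_comm, opα_mul_opδ,
    opα_mul_opγ, opγ_mul_opδ, opδ_mul_opα]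
  simp only [← hr] at *
  match_scalars <;> field_simp <;>
    first
    | ring1
    | linear_combination (-(u ^ 2 * (1 + t ^ 2))) * Complex.I_sq

end images

/-! ### The eigenvectors of `π(ρ_{τ,∞})` -/

section eigenvectors
variable {q : ℝ} (hq : q ∈ Set.Ioo (0 : ℝ) 1) {s : ℝ}

theorem opQ_apply (x : Ell2) (k : ℕ) :
    opQ hq s x k = s * (wt q (k + 1) * x (k + 1)) - Complex.I * (q ^ k * x k) := by
  change (s : ℂ) * opα hq x k - Complex.I * opγ hq x k = _
  rw [opα_apply, opγ_apply, Complex.ofReal_pow]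

theorem opP_apply_zero (x : Ell2) : opP hq s x 0 = Complex.I * x 0 := by
  change Complex.I * opγ hq x 0 + (s : ℂ) * opδ hq x 0 = _
  simp [opδ_apply_zero, opγ_apply]

theorem opP_apply_succ (x : Ell2) (k : ℕ) :
    opP hq s x (k + 1) = Complex.I * (q ^ (k + 1) * x (k + 1)) + s * (wt q (k + 1) * x k) := by
  change Complex.I * opγ hq x (k + 1) + (s : ℂ) * opδ hq x (k + 1) = _
  rw [opδ_apply_succ, opγ_apply, Complex.ofReal_pow]

theorem opA_apply (x : Ell2) (k : ℕ) :
    opA hq s x k = (s : ℂ) ^ 2 * x k - opP hq s (opQ hq s x) k := rfl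

include hq in
theorem wt_succ_pos (k : ℕ) : 0 < wt q (k + 1) := by
  refine Real.sqrt_pos.mpr ?_
  have := pow_lt_one₀ hq.1.le hq.2 (show 2 * (k + 1) ≠ 0 by omega)
  linarith

include hq in
theorem wt_sq' (n : ℕ) : (wt q n : ℂ) ^ 2 = 1 - (q : ℂ) ^ (2 * n) := by
  exact_mod_cast (sq (wt q n)).trans (wt_sq hq n)

/-- The eigenvalue equation for `π(ρ_{τ,∞})` is a three-term recurrence, so an eigenvector is
determined by its coordinate at `e 0`. -/
theorem eq_zero_of_opA_eq_smul (hs : s ≠ 0) {lam : ℂ} {x : Ell2} (hx : opA hq s x = lam • x)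
    (h0 : x 0 = 0) : x = 0 := by
  have hs' : (s : ℂ) ≠ 0 := by exact_mod_cast hs
  have hq0 : (q : ℂ) ≠ 0 := by exact_mod_cast hq.1.ne'
  have hw : ∀ k, (wt q (k + 1) : ℂ) ≠ 0 := fun k => by exact_mod_cast (wt_succ_pos hq k).ne'
  have hrow : ∀ k, (s : ℂ) ^ 2 * x k - opP hq s (opQ hq s x) k = lam * x k := fun k => by
    rw [← opA_apply, hx]
    rfl
  have key : ∀ k, x k = 0 ∧ x (k + 1) = 0 := by
    intro k
    induction k with
    | zero =>
      refine ⟨h0, ?_⟩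
      have h := hrow 0
      rw [opP_apply_zero, opQ_apply, h0] at h
      simpa [hs', hw 0] using h
    | succ k ih =>
      refine ⟨ih.2, ?_⟩
      have h := hrow (k + 1)
      rw [opP_apply_succ, opQ_apply, opQ_apply, ih.1, ih.2] at h
      simpa [hs', hw (k + 1), hq0] using h
  ext k
  exact (key k).1

theorem eq_smul_of_opA_eq_smul (hs : s ≠ 0) {lam : ℂ} {x y : Ell2} (hx : opA hq s x = lam • x)
    (hy : opA hq s y = lam • y) (hy0 : y 0 = 1) : x = x 0 • y := by
  refine sub_eq_zero.mp (eq_zero_of_opA_eq_smul hq hs (lam := lam) ?_ ?_)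
  · rw [map_sub, map_smul, hx, hy, smul_sub, smul_comm]
  · change x 0 - x 0 * y 0 = 0
    rw [hy0, mul_one, sub_self]

theorem opRaise_apply_zero (x : Ell2) : opRaise hq s x 0 = q * s * x 0 := by
  change opP hq s (opY hq s x) 0 = _
  rw [opP_apply_zero]
  change Complex.I * (opδ hq x 0 - Complex.I * q * s * opγ hq x 0) = _
  rw [opδ_apply_zero, opγ_apply, pow_zero, Complex.ofReal_one]
  linear_combination (-(q : ℂ) * s * x 0) * Complex.I_sq

/-- On an eigenvector of `opA` the lowering operator changes the coordinate at `e 0` by a factor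
that vanishes at the eigenvalue `-1`: the rows `0` and `1` of the eigenvalue equation express the
coordinates at `e 1` and `e 2` through the one at `e 0`. -/
theorem opLower_apply_zero {lam : ℂ} {x : Ell2} (hx : opA hq s x = lam • x) :
    q * s * opLower hq s x 0 = (1 + lam) * (s ^ 2 - lam) * x 0 := by
  have hrow : ∀ k, (s : ℂ) ^ 2 * x k - opP hq s (opQ hq s x) k = lam * x k := fun k => by
    rw [← opA_apply, hx]
    rfl
  have h0 := hrow 0
  have h1 := hrow 1
  have hy0 := opQ_apply hq (s := s) x 0
  have hw := wt_sq' hq 1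
  rw [opP_apply_zero] at h0
  rw [opP_apply_succ] at h1
  have hl : opLower hq s x 0 = wt q 1 * opQ hq s x 1 + Complex.I * q * s * opQ hq s x 0 := by
    change opα hq (opQ hq s x) 0 + Complex.I * q * s * opγ hq (opQ hq s x) 0 = _
    rw [opα_apply, opγ_apply]
    simp
  rw [hl]
  simp only [pow_zero, zero_add, pow_one, one_mul, mul_one] at *
  generalize opQ hq s x 0 = y0 at *
  generalize opQ hq s x 1 = y1 at *
  generalize x 0 = x0 at *
  generalize x 1 = x1 at *
  generalize (wt q 1 : ℂ) = w at *
  have hI := Complex.I_sq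
  generalize Complex.I = I at *
  -- `h0` gives `y0`, the definition of `y0` gives `w * x1`, and `h1` gives `w * y1`.
  have e0 : y0 = I * (lam - s ^ 2) * x0 := by linear_combination I * h0 + y0 * hI
  have e1 : (s : ℂ) * (w * x1) = I * (lam - s ^ 2 + 1) * x0 := by
    linear_combination e0 - hy0
  have e2 : I * q * w * y1 = (s ^ 2 - lam) * (w * x1) - s * w ^ 2 * y0 := by
    linear_combination (-w) * h1
  have e3 : (q : ℂ) * s * w * y1 = -I * s * (I * q * w * y1) := by
    linear_combination ((q : ℂ) * s * w * y1) * hI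
  have : (q : ℂ) * s * (w * y1 + I * q * s * y0) =
      -I * (s ^ 2 - lam) * (s * (w * x1)) + I * s ^ 2 * w ^ 2 * y0 + I * q ^ 2 * s ^ 2 * y0 := by
    linear_combination e3 - I * s * e2
  rw [this, e1, hw, e0]
  linear_combination (-(s ^ 2 - lam) * (lam - s ^ 2 + 1) * x0 + s ^ 2 * (lam - s ^ 2) * x0) * hI

/-- The coordinates of `v_0`, the solution of the eigenvalue equation for `-1`. -/
noncomputable def groundCoord (q s : ℝ) (k : ℕ) : ℂ :=
  ∏ j ∈ Finset.range k, (-Complex.I * (s * q ^ j / wt q (j + 1) : ℝ))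

include hq in
theorem norm_sq_groundCoord (k : ℕ) :
    ‖groundCoord q s k‖ ^ 2 = eulerTerm (q ^ 2) (s ^ 2) k := by
  rw [groundCoord, eulerTerm, norm_prod, ← Finset.prod_pow]
  refine Finset.prod_congr rfl fun j _ => ?_
  rw [norm_mul, norm_neg, Complex.norm_I, one_mul, Complex.norm_real, Real.norm_eq_abs, sq_abs,
    div_pow, sq (wt q (j + 1)), wt_sq hq, mul_pow, ← pow_mul, ← pow_mul, ← pow_mul, mul_comm j 2]

include hq in
theorem sq_mem_Ioo : q ^ 2 ∈ Set.Ioo (0 : ℝ) 1 :=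
  ⟨pow_pos hq.1 2, pow_lt_one₀ hq.1.le hq.2 two_ne_zero⟩

/-- The eigenvector `v_0`; its coordinates are square summable by Euler's series. -/
noncomputable def groundVec (hs : 0 < s) : Ell2 :=
  mkEll2 (groundCoord q s) (by
    simp only [norm_sq_groundCoord hq]
    exact summable_eulerTerm (sq_mem_Ioo hq) (by positivity))

theorem norm_sq_groundVec (hs : 0 < s) : ‖groundVec hq hs‖ ^ 2 = qPochInf (-s ^ 2) (q ^ 2) := by
  rw [Ell2.norm_sq, ← tsum_eulerTerm (sq_mem_Ioo hq) (by positivity)]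
  exact tsum_congr fun k => norm_sq_groundCoord hq k

theorem groundVec_zero (hs : 0 < s) : groundVec hq hs 0 = 1 := by
  change groundCoord q s 0 = 1
  simp [groundCoord]

theorem opQ_groundVec (hs : 0 < s) (k : ℕ) : opQ hq s (groundVec hq hs) k =
    -(Complex.I * q ^ k * (1 + s ^ 2)) * groundVec hq hs k := by
  have hw : (wt q (k + 1) : ℂ) ≠ 0 := by exact_mod_cast (wt_succ_pos hq k).ne'
  have h : groundVec hq hs (k + 1) =
      groundVec hq hs k * (-Complex.I * (s * q ^ k / wt q (k + 1) : ℝ)) :=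
    Finset.prod_range_succ _ _
  rw [opQ_apply, h]
  push_cast
  field_simp
  ring

theorem opA_groundVec (hs : 0 < s) : opA hq s (groundVec hq hs) = (-1 : ℂ) • groundVec hq hs := by
  ext k
  rw [opA_apply, lp.coeFn_smul, Pi.smul_apply, smul_eq_mul]
  rcases k with _ | k
  · rw [opP_apply_zero, opQ_groundVec]
    linear_combination ((1 + s ^ 2) * groundVec hq hs 0) * Complex.I_sq
  · have hw : (wt q (k + 1) : ℂ) ≠ 0 := by exact_mod_cast (wt_succ_pos hq k).ne'
    have h : groundVec hq hs (k + 1) =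
        groundVec hq hs k * (-Complex.I * (s * q ^ k / wt q (k + 1) : ℝ)) :=
      Finset.prod_range_succ _ _
    have h' : wt q (k + 1) * groundVec hq hs (k + 1) =
        -Complex.I * s * q ^ k * groundVec hq hs k := by
      rw [h]
      push_cast
      field_simp
    have hw2 := wt_sq' hq (k + 1)
    rw [opP_apply_succ, opQ_groundVec, opQ_groundVec]
    have hx : s * (wt q (k + 1) * (-(Complex.I * q ^ k * (1 + s ^ 2)) * groundVec hq hs k)) =
        (1 + s ^ 2) * (wt q (k + 1) ^ 2 * groundVec hq hs (k + 1)) := by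
      linear_combination (-(1 + (s : ℂ) ^ 2) * wt q (k + 1)) * h'
    rw [hx, hw2]
    linear_combination ((1 + s ^ 2) * q ^ (2 * (k + 1)) * groundVec hq hs (k + 1)) * Complex.I_sq

/-- The raising operator produces the eigenvectors for `-q^{2n}` from `v_0`. -/
noncomputable def eigVec (hs : 0 < s) : ℕ → Ell2
  | 0 => groundVec hq hs
  | n + 1 => ((q : ℂ) * s)⁻¹ • opRaise hq s (eigVec hs n)

theorem opA_opRaise {lam : ℂ} {x : Ell2} (hx : opA hq s x = lam • x) :
    opA hq s (opRaise hq s x) = ((q : ℂ) ^ 2 * lam) • opRaise hq s x := by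
  have := DFunLike.congr_fun (opA_mul_opRaise hq s) x
  change opA hq s (opRaise hq s x) = (q : ℂ) ^ 2 • opRaise hq s (opA hq s x) at this
  rw [this, hx, map_smul, smul_smul]

theorem opA_opLower {lam : ℂ} {x : Ell2} (hx : opA hq s x = ((q : ℂ) ^ 2 * lam) • x) :
    opA hq s (opLower hq s x) = lam • opLower hq s x := by
  have hq0 : (q : ℂ) ^ 2 ≠ 0 := pow_ne_zero 2 (by exact_mod_cast hq.1.ne')
  have := DFunLike.congr_fun (opLower_mul_opA hq s) x
  change opLower hq s (opA hq s x) = (q : ℂ) ^ 2 • opA hq s (opLower hq s x) at this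
  rw [hx, map_smul, mul_smul] at this
  exact (smul_right_injective _ hq0 this).symm

theorem eigVec_spec (hs : 0 < s) (n : ℕ) :
    opA hq s (eigVec hq hs n) = (-(q : ℂ) ^ (2 * n)) • eigVec hq hs n ∧ eigVec hq hs n 0 = 1 := by
  have hs' : (s : ℂ) ≠ 0 := by exact_mod_cast hs.ne'
  have hq0 : (q : ℂ) ≠ 0 := by exact_mod_cast hq.1.ne'
  induction n with
  | zero => exact ⟨by simpa [eigVec] using opA_groundVec hq hs, groundVec_zero hq hs⟩
  | succ n ih =>
    constructor
    · rw [eigVec, map_smul, opA_opRaise hq ih.1, smul_comm]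
      congr 1
      ring
    · rw [eigVec, lp.coeFn_smul, Pi.smul_apply, opRaise_apply_zero, ih.2, mul_one, smul_eq_mul,
        inv_mul_cancel₀ (mul_ne_zero hq0 hs')]

end eigenvectors

theorem inner_self_eq_norm_sq_complex {E : Type*} [NormedAddCommGroup E] [InnerProductSpace ℂ E]
    (x : E) : inner ℂ x x = ((‖x‖ ^ 2 : ℝ) : ℂ) := by
  rw [inner_self_eq_norm_sq_to_K]
  exact (Complex.ofReal_pow _ _).symm

section eigenSeq
variable {q : ℝ} (hq : q ∈ Set.Ioo (0 : ℝ) 1) {τ : ℝ}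

theorem isNormalizedEigenvector_iff {lam : ℂ} {w : Ell2} :
    IsNormalizedEigenvector hq τ lam w ↔ opA hq (q ^ τ) w = lam • w ∧ w 0 = 1 := by
  rw [IsNormalizedEigenvector, rep_rhoInf, inner_e]

theorem existsUnique_isEigenSeq (τ : ℝ) : ∃! v : ℕ → Ell2, IsEigenSeq hq τ v := by
  have hs : 0 < q ^ τ := Real.rpow_pos_of_pos hq.1 _
  refine ⟨eigVec hq hs, fun n => (isNormalizedEigenvector_iff hq).mpr (eigVec_spec hq hs n), ?_⟩
  intro v hv
  funext n
  obtain ⟨h1, h2⟩ := (isNormalizedEigenvector_iff hq).mp (hv n)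
  obtain ⟨h3, h4⟩ := eigVec_spec hq hs n
  rw [eq_smul_of_opA_eq_smul hq hs.ne' h1 h3 h4, h2, one_smul]

variable {hq} {v : ℕ → Ell2} (hv : IsEigenSeq hq τ v)
include hv

theorem IsEigenSeq.opA_apply (n : ℕ) : opA hq (q ^ τ) (v n) = (-(q : ℂ) ^ (2 * n)) • v n :=
  ((isNormalizedEigenvector_iff hq).mp (hv n)).1

theorem IsEigenSeq.apply_zero (n : ℕ) : v n 0 = 1 :=
  ((isNormalizedEigenvector_iff hq).mp (hv n)).2

theorem IsEigenSeq.opRaise_apply (n : ℕ) :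
    opRaise hq (q ^ τ) (v n) = ((q * q ^ τ : ℝ) : ℂ) • v (n + 1) := by
  have hs : 0 < q ^ τ := Real.rpow_pos_of_pos hq.1 _
  have h := opA_opRaise hq (hv.opA_apply n)
  rw [show (q : ℂ) ^ 2 * -(q : ℂ) ^ (2 * n) = -(q : ℂ) ^ (2 * (n + 1)) by ring] at h
  rw [eq_smul_of_opA_eq_smul hq hs.ne' h (hv.opA_apply (n + 1)) (hv.apply_zero (n + 1)),
    opRaise_apply_zero, hv.apply_zero, mul_one, Complex.ofReal_mul]

/-- The lowering operator sends `v_n` to a multiple of `v_{n-1}`. For `n = 0` the coefficient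
vanishes, so the truncated index `n - 1` is harmless. -/
theorem IsEigenSeq.opLower_apply (n : ℕ) :
    opLower hq (q ^ τ) (v n) = ((q ^ τ / q * recCoeff q τ n : ℝ) : ℂ) • v (n - 1) := by
  have hs : 0 < q ^ τ := Real.rpow_pos_of_pos hq.1 _
  have hs' : ((q ^ τ : ℝ) : ℂ) ≠ 0 := by exact_mod_cast hs.ne'
  have hq0 : (q : ℂ) ≠ 0 := by exact_mod_cast hq.1.ne'
  have hcoord : opLower hq (q ^ τ) (v n) 0 = ((q ^ τ / q * recCoeff q τ n : ℝ) : ℂ) := by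
    have h := opLower_apply_zero hq (hv.opA_apply n)
    rw [hv.apply_zero, mul_one] at h
    refine mul_left_cancel₀ (mul_ne_zero hq0 hs') (h.trans ?_)
    rw [recCoeff]
    push_cast
    field_simp
    ring
  rcases n with _ | n
  · have h := opA_opLower hq (lam := (-(q : ℂ) ^ 2)⁻¹) (x := v 0) (s := q ^ τ) (by
      rw [hv.opA_apply]
      congr 1
      field_simp
      simp)
    have hz : recCoeff q τ 0 = 0 := by simp [recCoeff]
    rw [eq_zero_of_opA_eq_smul hq hs.ne' h (by rw [hcoord, hz]; simp), hz]
    simp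
  · have h := opA_opLower hq (lam := -(q : ℂ) ^ (2 * n)) (x := v (n + 1)) (s := q ^ τ) (by
      rw [hv.opA_apply]
      congr 1
      ring)
    rw [eq_smul_of_opA_eq_smul hq hs.ne' h (hv.opA_apply n) (hv.apply_zero n), hcoord,
      Nat.add_sub_cancel]

theorem IsEigenSeq.inner_eq_zero {n k : ℕ} (h : n ≠ k) : inner ℂ (v n) (v k) = 0 := by
  have h1 : inner ℂ (opA hq (q ^ τ) (v n)) (v k) = inner ℂ (v n) (opA hq (q ^ τ) (v k)) := by
    rw [← ContinuousLinearMap.adjoint_inner_right, adjoint_opA]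
  rw [hv.opA_apply, hv.opA_apply, inner_smul_left, inner_smul_right, map_neg, map_pow,
    Complex.conj_ofReal, ← sub_eq_zero, ← sub_mul] at h1
  refine (mul_eq_zero.mp h1).resolve_left fun h2 => h ?_
  have h3 : q ^ (2 * n) = q ^ (2 * k) := by
    have : (q : ℂ) ^ (2 * n) = (q : ℂ) ^ (2 * k) := by linear_combination -h2
    exact_mod_cast this
  have := (pow_right_strictAnti₀ hq.1 hq.2).injective h3
  omega

theorem IsEigenSeq.norm_sq_zero : ‖v 0‖ ^ 2 = qPochInf (-(q ^ (2 * τ))) (q ^ 2) := by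
  have hs : 0 < q ^ τ := Real.rpow_pos_of_pos hq.1 _
  have h0 := hv.opA_apply 0
  simp only [mul_zero, pow_zero] at h0
  rw [eq_smul_of_opA_eq_smul hq hs.ne' h0 (opA_groundVec hq hs) (groundVec_zero hq hs),
    hv.apply_zero, one_smul, norm_sq_groundVec, ← Real.rpow_mul_natCast hq.1.le]
  congr 3
  push_cast
  ring

/-- Evaluate `⟨R v_n, v_{n+1}⟩ = ⟨v_n, R* v_{n+1}⟩` for the raising operator `R`. -/
theorem IsEigenSeq.norm_sq_succ (n : ℕ) :
    ‖v (n + 1)‖ ^ 2 = (q ^ 2)⁻¹ * recCoeff q τ (n + 1) * ‖v n‖ ^ 2 := by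
  have hs : 0 < q ^ τ := Real.rpow_pos_of_pos hq.1 _
  have hq0 := hq.1
  have h1 : inner ℂ (opRaise hq (q ^ τ) (v n)) (v (n + 1)) =
      inner ℂ (v n) (opLower hq (q ^ τ) (v (n + 1))) := by
    rw [← ContinuousLinearMap.adjoint_inner_right, adjoint_opRaise]
  rw [hv.opRaise_apply, hv.opLower_apply, Nat.add_sub_cancel, inner_smul_left, inner_smul_right,
    inner_self_eq_norm_sq_complex, inner_self_eq_norm_sq_complex, Complex.conj_ofReal] at h1
  have h2 : q * q ^ τ * ‖v (n + 1)‖ ^ 2 = q ^ τ / q * recCoeff q τ (n + 1) * ‖v n‖ ^ 2 := by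
    exact Complex.ofReal_injective (by rw [Complex.ofReal_mul, h1, ← Complex.ofReal_mul])
  refine mul_left_cancel₀ (mul_pos hq0 hs).ne' (h2.trans ?_)
  field_simp

theorem IsEigenSeq.repComul_rho_apply (σ φ : ℝ) (n : ℕ) :
    repComul hq (φ / 2) (rho q τ σ) (v n) =
      (2 : ℂ)⁻¹ • ((Complex.exp (-(Complex.I * φ)) * q) • v (n + 1)
        + ((q / q ^ τ * (q ^ σ - (q ^ σ)⁻¹) * q ^ (2 * n) : ℝ) : ℂ) • v n
        + (Complex.exp (Complex.I * φ) * ((q⁻¹ * recCoeff q τ n : ℝ) : ℂ)) • v (n - 1)) := by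
  have hs' : ((q ^ τ : ℝ) : ℂ) ≠ 0 := by exact_mod_cast (Real.rpow_pos_of_pos hq.1 τ).ne'
  have hq0 : (q : ℂ) ≠ 0 := by exact_mod_cast hq.1.ne'
  rw [repComul_rho]
  simp only [smul_apply, add_apply, hv.opRaise_apply,
    hv.opLower_apply, hv.opA_apply]
  simp only [Complex.ofReal_mul, Complex.ofReal_sub, Complex.ofReal_div, Complex.ofReal_inv,
    Complex.ofReal_pow]
  generalize ((q ^ τ : ℝ) : ℂ) = s at *
  generalize ((q ^ σ : ℝ) : ℂ) = t at *
  match_scalars <;> field_simp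
  ring

theorem IsEigenSeq.norm_pos (n : ℕ) : 0 < ‖v n‖ := by
  rw [norm_pos_iff]
  intro h
  have := hv.apply_zero n
  rw [h] at this
  simp at this

end eigenSeq

theorem adjoint_repComul_rho {q : ℝ} (hq : q ∈ Set.Ioo (0 : ℝ) 1) (τ σ φ : ℝ) :
    ContinuousLinearMap.adjoint (repComul hq (φ / 2) (rho q τ σ)) =
      repComul hq (φ / 2) (rho q τ σ) := by
  rw [repComul_rho]
  simp only [map_smulₛₗ, map_add, adjoint_opRaise, adjoint_opLower, adjoint_opA, map_inv₀, map_mul,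
    Complex.conj_ofReal, Complex.conj_ofNat, ← Complex.exp_conj, map_neg, Complex.conj_I]
  rw [neg_mul, neg_neg]
  module

/-! ### The spectral measure of a bounded self-adjoint operator -/

section spectral
variable {E : Type*} [NormedAddCommGroup E] [InnerProductSpace ℂ E] [CompleteSpace E]

/-- The positive functional `f ↦ ⟨x, f(T) x⟩` on continuous functions on the spectrum of `T`. -/
noncomputable def spectralFunctional {T : E →L[ℂ] E} (hT : IsSelfAdjoint T) (x : E) :
    CompactlySupportedContinuousMap (spectrum ℝ T) ℝ →ₚ[ℝ] ℝ :=
  PositiveLinearMap.mk₀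
    { toFun := fun f => (inner ℂ x (cfcHom hT (f : C(spectrum ℝ T, ℝ)) x)).re
      map_add' := fun f g => by
        have : ((f + g : CompactlySupportedContinuousMap (spectrum ℝ T) ℝ) : C(spectrum ℝ T, ℝ)) =
          (f : C(spectrum ℝ T, ℝ)) + (g : C(spectrum ℝ T, ℝ)) := rfl
        rw [this, map_add, add_apply, inner_add_right, Complex.add_re]
      map_smul' := fun c f => by
        have : ((c • f : CompactlySupportedContinuousMap (spectrum ℝ T) ℝ) : C(spectrum ℝ T, ℝ)) =
          c • (f : C(spectrum ℝ T, ℝ)) := rfl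
        rw [this, map_smul, smul_apply, ← Complex.coe_smul, inner_smul_right, Complex.re_ofReal_mul]
        rfl } (by
    intro f hf
    -- a nonnegative function is a square, and `⟨x, g(T)² x⟩ = ‖g(T) x‖²`
    let g : C(spectrum ℝ T, ℝ) := ⟨fun y => √(f y), by fun_prop⟩
    have hg : (f : C(spectrum ℝ T, ℝ)) = star g * g := by
      ext y
      exact (Real.mul_self_sqrt (hf y)).symm
    change 0 ≤ (inner ℂ x (cfcHom hT (f : C(spectrum ℝ T, ℝ)) x)).re
    rw [hg, map_mul, map_star, ContinuousLinearMap.star_eq_adjoint]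
    change 0 ≤ (inner ℂ x (ContinuousLinearMap.adjoint (cfcHom hT g) (cfcHom hT g x))).re
    rw [ContinuousLinearMap.adjoint_inner_right]
    exact inner_self_nonneg (𝕜 := ℂ))

/-- The moments `⟨x, Tⁿ x⟩` of a bounded self-adjoint operator are those of a finite measure. -/
theorem exists_spectralMeasure {T : E →L[ℂ] E} (hT : IsSelfAdjoint T) (x : E) :
    ∃ m : Measure ℝ, IsFiniteMeasure m ∧ ∀ P : Polynomial ℝ,
      Integrable (fun y => P.eval y) m ∧
        ∫ y, P.eval y ∂m = (inner ℂ x (Polynomial.aeval T P x)).re := by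
  have : CompactSpace (spectrum ℝ T) := isCompact_iff_compactSpace.mp (spectrum.isCompact T)
  let μ := RealRMK.rieszMeasure (spectralFunctional hT x)
  have hemb : MeasurableEmbedding (Subtype.val : spectrum ℝ T → ℝ) :=
    MeasurableEmbedding.subtype_coe (spectrum.isCompact T).measurableSet
  refine ⟨μ.map Subtype.val, inferInstance, fun P => ⟨?_, ?_⟩⟩
  · rw [hemb.integrable_map_iff]
    have hc : Continuous ((fun y => P.eval y) ∘ (Subtype.val : spectrum ℝ T → ℝ)) :=
      P.continuous.comp continuous_subtype_val
    exact hc.integrable_of_hasCompactSupport (HasCompactSupport.of_compactSpace _)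
  · rw [hemb.integral_map]
    let f : C(spectrum ℝ T, ℝ) := Polynomial.aeval ((ContinuousMap.id ℝ).restrict (spectrum ℝ T)) P
    have hf : ∀ y, f y = P.eval (y : ℝ) := fun y => by
      simp only [f, Polynomial.aeval_continuousMap_apply]
      simp
    have h1 := RealRMK.integral_rieszMeasure (spectralFunctional hT x)
      (CompactlySupportedContinuousMap.continuousMapEquiv f)
    have h2 : cfcHom hT f = Polynomial.aeval T P := by
      rw [← Polynomial.aeval_algHom_apply (cfcHom hT : C(spectrum ℝ T, ℝ) →⋆ₐ[ℝ] (E →L[ℂ] E)),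
        cfcHom_id]
    rw [← h2]
    refine Eq.trans ?_ h1
    exact integral_congr_ae (.of_forall fun y => (hf y).symm)

theorem adjoint_aeval {T : E →L[ℂ] E} (hT : IsSelfAdjoint T) (P : Polynomial ℝ) :
    ContinuousLinearMap.adjoint (Polynomial.aeval T P) = Polynomial.aeval T P := by
  rw [← cfc_polynomial (R := ℝ) P T hT]
  exact cfc_predicate (R := ℝ) _ T

omit [CompleteSpace E] in
theorem abs_inner_pow_le (T : E →L[ℂ] E) (x : E) (n : ℕ) :
    |(inner ℂ x ((T ^ n) x)).re| ≤ ‖x‖ ^ 2 * ‖T‖ ^ n := by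
  refine (Complex.abs_re_le_norm _).trans ((norm_inner_le_norm _ _).trans ?_)
  rw [sq, mul_assoc]
  refine mul_le_mul_of_nonneg_left ?_ (norm_nonneg _)
  rw [mul_comm]
  refine ((T ^ n).le_opNorm x).trans (mul_le_mul_of_nonneg_right ?_ (norm_nonneg _))
  rcases n with _ | n
  · rw [pow_zero, pow_zero]
    exact ContinuousLinearMap.norm_id_le (𝕜 := ℂ) (E := E)
  · exact norm_pow_le' T n.succ_pos

end spectral

/-! ### Measures with exponentially bounded moments -/

section moments
variable {m : Measure ℝ} [IsFiniteMeasure m] {B : ℝ}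

/-- A measure whose moments grow at most like `Bⁿ` is concentrated on `[-B, B]`. -/
theorem ae_abs_le_of_moments (hB : 0 ≤ B) (hm : ∀ n : ℕ, Integrable (fun x : ℝ => x ^ n) m) {C : ℝ}
    (hC : ∀ n : ℕ, ∫ x, x ^ n ∂m ≤ C * B ^ n) : ∀ᵐ x ∂m, |x| ≤ B := by
  have key : ∀ r, B < r → m {x | r ≤ |x|} = 0 := by
    intro r hr
    have hr0 : 0 < r := hB.trans_lt hr
    have hbound : ∀ n : ℕ, m.real {x | r ≤ |x|} ≤ C * ((B / r) ^ 2) ^ n := by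
      intro n
      have h1 := mul_meas_ge_le_integral_of_nonneg (μ := m) (f := fun x : ℝ => x ^ (2 * n))
        (.of_forall fun x => (even_two_mul n).pow_nonneg x) (hm _) (r ^ (2 * n))
      have h2 : m.real {x | r ≤ |x|} ≤ m.real {x | r ^ (2 * n) ≤ x ^ (2 * n)} := by
        refine measureReal_mono fun x hx => ?_
        have : r ^ (2 * n) ≤ |x| ^ (2 * n) := pow_le_pow_left₀ hr0.le hx _
        rwa [(even_two_mul n).pow_abs] at this
      have h3 := (mul_le_mul_of_nonneg_left h2 (pow_nonneg hr0.le (2 * n))).trans (h1.trans (hC _))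
      rw [← pow_mul, div_pow, ← mul_div_assoc, le_div_iff₀ (pow_pos hr0 _), mul_comm]
      exact h3
    have hlt : (B / r) ^ 2 < 1 := pow_lt_one₀ (by positivity) ((div_lt_one hr0).mpr hr) two_ne_zero
    have hlim := (tendsto_pow_atTop_nhds_zero_of_lt_one (sq_nonneg (B / r)) hlt).const_mul C
    rw [mul_zero] at hlim
    have h0 : m.real {x | r ≤ |x|} ≤ 0 := ge_of_tendsto' hlim hbound
    exact (measureReal_eq_zero_iff).mp (le_antisymm h0 measureReal_nonneg)
  rw [ae_iff]
  refine measure_mono_null (t := ⋃ k : ℕ, {x : ℝ | B + 1 / (k + 1) ≤ |x|}) ?_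
    (measure_iUnion_null fun k => key _ ?_)
  · intro x hx
    obtain ⟨k, hk⟩ := exists_nat_one_div_lt (sub_pos.mpr (not_le.mp hx))
    exact Set.mem_iUnion.mpr ⟨k, show B + 1 / (k + 1) ≤ |x| by linarith⟩
  · have : (0 : ℝ) < 1 / (k + 1) := Nat.one_div_pos_of_nat
    linarith

theorem abs_integral_sub_le (hm : ∀ᵐ x ∂m, |x| ≤ B) {f g : ℝ → ℝ} (hf : Integrable f m)
    (hg : Integrable g m) {ε : ℝ} (h : ∀ x ∈ Set.Icc (-B) B, |g x - f x| < ε) :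
    |∫ x, g x ∂m - ∫ x, f x ∂m| ≤ ε * m.real Set.univ := by
  rw [← integral_sub hg hf]
  exact norm_integral_le_of_norm_le_const (f := fun x => g x - f x)
    (hm.mono fun x hx => (h x (abs_le.mp hx)).le)

/-- A measure on a bounded interval is determined by its moments (Weierstrass). -/
theorem eq_of_integral_polynomial_eq {m' : Measure ℝ} [IsFiniteMeasure m']
    (hm : ∀ᵐ x ∂m, |x| ≤ B) (hm' : ∀ᵐ x ∂m', |x| ≤ B)
    (hi : ∀ P : Polynomial ℝ, Integrable (fun x => P.eval x) m)
    (hi' : ∀ P : Polynomial ℝ, Integrable (fun x => P.eval x) m')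
    (h : ∀ P : Polynomial ℝ, ∫ x, P.eval x ∂m = ∫ x, P.eval x ∂m') : m = m' := by
  refine ext_of_forall_integral_eq_of_IsFiniteMeasure fun f => ?_
  by_contra hne
  have hpos : 0 < |∫ x, f x ∂m - ∫ x, f x ∂m'| := abs_pos.mpr (sub_ne_zero.mpr hne)
  set d := |∫ x, f x ∂m - ∫ x, f x ∂m'|
  set K := m.real Set.univ + m'.real Set.univ + 1
  have h1 : 0 ≤ m.real Set.univ := measureReal_nonneg
  have h2 : 0 ≤ m'.real Set.univ := measureReal_nonneg
  have hK : 0 < K := by positivity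
  obtain ⟨P, hP⟩ := exists_polynomial_near_of_continuousOn (-B) B f f.continuous.continuousOn
    (d / K) (by positivity)
  have e1 := abs_integral_sub_le hm (f.integrable m) (hi P) hP
  have e2 := abs_integral_sub_le hm' (f.integrable m') (hi' P) hP
  rw [h P] at e1
  have h3 : d ≤ d / K * m.real Set.univ + d / K * m'.real Set.univ := by
    have := abs_sub_le (∫ x, f x ∂m) (∫ x, P.eval x ∂m') (∫ x, f x ∂m')
    rw [abs_sub_comm (∫ x, f x ∂m) (∫ x, P.eval x ∂m')] at this
    linarith
  have h4 : d / K * K = d := div_mul_cancel₀ _ hK.ne'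
  have h5 : 0 < d / K := by positivity
  have h6 : d / K * K = d / K * m.real Set.univ + d / K * m'.real Set.univ + d / K := by
    simp only [K]
    ring
  linarith

/-! ### Polynomials and multiplication by `x` in `L²` of a measure on a bounded interval -/

variable (hm : ∀ᵐ x ∂m, |x| ≤ B)
include hm

theorem memLp_of_continuous {f : ℝ → ℂ} (hf : Continuous f) : MemLp f 2 m := by
  obtain ⟨C, hC⟩ := (isCompact_Icc (a := -B) (b := B)).exists_bound_of_continuousOn hf.continuousOn
  exact MemLp.of_bound hf.aestronglyMeasurable C (hm.mono fun x hx => hC x (abs_le.mp hx))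

theorem memLp_polynomial (P : Polynomial ℝ) : MemLp (fun x : ℝ => ((P.eval x : ℝ) : ℂ)) 2 m :=
  memLp_of_continuous hm (Complex.continuous_ofReal.comp P.continuous)

/-- A real polynomial as an element of the complex Hilbert space `L²`; only real scalars act on
real polynomials, hence the real linearity. -/
noncomputable def polyLp : Polynomial ℝ →ₗ[ℝ] Lp ℂ 2 m where
  toFun P := (memLp_polynomial hm P).toLp _
  map_add' P Q := by
    rw [← MemLp.toLp_add]
    exact MemLp.toLp_congr _ _ (.of_forall fun x => by simp)
  map_smul' c P := by
    rw [RingHom.id_apply, ← MemLp.toLp_const_smul]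
    exact MemLp.toLp_congr _ _ (.of_forall fun x => by simp)

theorem coeFn_polyLp (P : Polynomial ℝ) :
    polyLp hm P =ᵐ[m] fun x : ℝ => ((P.eval x : ℝ) : ℂ) :=
  MemLp.coeFn_toLp (memLp_polynomial hm P)

theorem inner_polyLp (P Q : Polynomial ℝ) :
    inner ℂ (polyLp hm P) (polyLp hm Q) = ((∫ x, (P * Q).eval x ∂m : ℝ) : ℂ) := by
  rw [L2.inner_def, ← integral_complex_ofReal]
  refine integral_congr_ae ?_
  filter_upwards [coeFn_polyLp hm P, coeFn_polyLp hm Q] with x hP hQ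
  rw [hP, hQ, RCLike.inner_apply, Complex.conj_ofReal, Polynomial.eval_mul]
  rw [Complex.ofReal_mul, mul_comm]

/-- Polynomials are dense in `L²` of a measure on a bounded interval. -/
theorem eq_top_of_polyLp_mem {K : Submodule ℂ (Lp ℂ 2 m)} (hK : IsClosed (K : Set (Lp ℂ 2 m)))
    (h : ∀ P, polyLp hm P ∈ K) : K = ⊤ := by
  have hreal : ∀ f : ℝ → ℝ, ∀ hf : Continuous f,
      (memLp_of_continuous hm (Complex.continuous_ofReal.comp hf)).toLp _ ∈ K := by
    intro f hf
    rw [← SetLike.mem_coe, ← hK.closure_eq, Metric.mem_closure_iff]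
    intro ε hε
    set c : ℝ := measureUnivNNReal m ^ ((2 : ℝ≥0∞).toReal)⁻¹
    have hc : 0 ≤ c := by positivity
    obtain ⟨P, hP⟩ := exists_polynomial_near_of_continuousOn (-B) B f hf.continuousOn
      (ε / (c + 1)) (by positivity)
    refine ⟨polyLp hm P, h P, ?_⟩
    rw [dist_comm, dist_eq_norm]
    have hle := Lp.norm_le_of_ae_bound (μ := m) (p := 2) (f := polyLp hm P -
        (memLp_of_continuous hm (Complex.continuous_ofReal.comp hf)).toLp _)
        (C := ε / (c + 1)) (by positivity) (by
      filter_upwards [hm, coeFn_polyLp hm P, Lp.coeFn_sub (polyLp hm P)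
          ((memLp_of_continuous hm (Complex.continuous_ofReal.comp hf)).toLp _),
        MemLp.coeFn_toLp (memLp_of_continuous hm (Complex.continuous_ofReal.comp hf))]
        with x hx h1 h2 h3
      rw [h2, Pi.sub_apply, h1, h3, Function.comp_apply, ← Complex.ofReal_sub, Complex.norm_real]
      exact (hP x (abs_le.mp hx)).le)
    refine hle.trans_lt ?_
    change c * (ε / (c + 1)) < ε
    rw [mul_div_assoc', div_lt_iff₀ (by positivity)]
    nlinarith
  have hdense := BoundedContinuousFunction.toLp_denseRange (p := 2) m (E := ℂ) ℂ (by norm_num)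
  rw [eq_top_iff]
  intro y _
  have hsub : Set.range (BoundedContinuousFunction.toLp (E := ℂ) 2 m ℂ) ⊆ (K : Set (Lp ℂ 2 m)) := by
    rintro _ ⟨g, rfl⟩
    have hre := hreal (fun x => (g x).re) (Complex.continuous_re.comp g.continuous)
    have him := hreal (fun x => (g x).im) (Complex.continuous_im.comp g.continuous)
    have : BoundedContinuousFunction.toLp (E := ℂ) 2 m ℂ g =
        MemLp.toLp _ (memLp_of_continuous hm (Complex.continuous_ofReal.comp
          (Complex.continuous_re.comp g.continuous))) + Complex.I • MemLp.toLp _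
          (memLp_of_continuous hm (Complex.continuous_ofReal.comp
            (Complex.continuous_im.comp g.continuous))) := by
      refine Lp.ext ?_
      rw [← MemLp.toLp_const_smul, ← MemLp.toLp_add]
      refine (BoundedContinuousFunction.coeFn_toLp 2 m ℂ g).trans
        (Filter.EventuallyEq.trans ?_ (MemLp.coeFn_toLp _).symm)
      refine .of_forall fun x => ?_
      simp [mul_comm Complex.I]
    rw [this]
    exact K.add_mem hre (K.smul_mem _ him)
  exact hK.closure_subset_iff.mpr hsub (hdense y)

omit [IsFiniteMeasure m] in
theorem memLp_mul_left (f : Lp ℂ 2 m) : MemLp (fun x : ℝ => (x : ℂ) * f x) 2 m :=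
  (Lp.memLp f).of_le_mul (c := B)
    (Complex.continuous_ofReal.aestronglyMeasurable.mul (Lp.aestronglyMeasurable f))
    (hm.mono fun x hx => by
      rw [norm_mul, Complex.norm_real]
      exact mul_le_mul_of_nonneg_right hx (norm_nonneg _))

/-- Multiplication by `x` on `L²`. -/
noncomputable def mulX : Lp ℂ 2 m →L[ℂ] Lp ℂ 2 m :=
  LinearMap.mkContinuous
    { toFun := fun f => (memLp_mul_left hm f).toLp _
      map_add' := fun f g => by
        rw [← MemLp.toLp_add]
        refine MemLp.toLp_congr _ _ ((Lp.coeFn_add f g).mono fun x hx => ?_)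
        simp only [hx, Pi.add_apply, mul_add]
      map_smul' := fun c f => by
        rw [RingHom.id_apply, ← MemLp.toLp_const_smul]
        refine MemLp.toLp_congr _ _ ((Lp.coeFn_smul c f).mono fun x hx => ?_)
        simp only [hx, Pi.smul_apply, smul_eq_mul, mul_left_comm] } B (fun f => by
    refine Lp.norm_le_mul_norm_of_ae_le_mul ?_
    filter_upwards [hm, MemLp.coeFn_toLp (memLp_mul_left hm f)] with x hx h1
    change ‖(memLp_mul_left hm f).toLp _ x‖ ≤ _
    rw [h1, norm_mul, Complex.norm_real]
    exact mul_le_mul_of_nonneg_right hx (norm_nonneg _))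

omit [IsFiniteMeasure m] in
theorem coeFn_mulX (f : Lp ℂ 2 m) : mulX hm f =ᵐ[m] fun x : ℝ => (x : ℂ) * f x :=
  MemLp.coeFn_toLp (memLp_mul_left hm f)

theorem mulX_polyLp (P : Polynomial ℝ) : mulX hm (polyLp hm P) = polyLp hm (Polynomial.X * P) := by
  refine Lp.ext ?_
  filter_upwards [coeFn_mulX hm (polyLp hm P), coeFn_polyLp hm P,
    coeFn_polyLp hm (Polynomial.X * P)] with x h1 h2 h3
  rw [h1, h2, h3]
  simp

end moments

/-! ### Unitary operators between spaces with orthogonal bases -/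

section unitary
variable {E F : Type*} [NormedAddCommGroup E] [InnerProductSpace ℂ E] [CompleteSpace E]
  [NormedAddCommGroup F] [InnerProductSpace ℂ F] [CompleteSpace F]

theorem exists_hilbertBasis_of_orthogonal {a : ℕ → E}
    (ho : ∀ n k, n ≠ k → inner ℂ (a n) (a k) = 0) (hne : ∀ n, 0 < ‖a n‖)
    (hd : (Submodule.span ℂ (Set.range a)).topologicalClosure = ⊤) :
    ∃ b : HilbertBasis ℕ ℂ E, ∀ n, a n = (‖a n‖ : ℂ) • b n := by
  have hon : Orthonormal ℂ fun n => (‖a n‖ : ℂ)⁻¹ • a n := by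
    refine ⟨fun n => ?_, fun n k h => ?_⟩
    · rw [norm_smul, norm_inv, Complex.norm_real, norm_norm, inv_mul_cancel₀ (hne n).ne']
    · change inner ℂ ((‖a n‖ : ℂ)⁻¹ • a n) ((‖a k‖ : ℂ)⁻¹ • a k) = 0
      rw [inner_smul_left, inner_smul_right, ho n k h, mul_zero, mul_zero]
  have hne' : ∀ n, (‖a n‖ : ℂ) ≠ 0 := fun n => by exact_mod_cast (hne n).ne'
  have hle : Submodule.span ℂ (Set.range a) ≤
      Submodule.span ℂ (Set.range fun n => (‖a n‖ : ℂ)⁻¹ • a n) := by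
    rw [Submodule.span_le]
    rintro _ ⟨n, rfl⟩
    have : a n = (‖a n‖ : ℂ) • ((‖a n‖ : ℂ)⁻¹ • a n) := by rw [smul_inv_smul₀ (hne' n)]
    rw [this]
    exact Submodule.smul_mem _ _ (Submodule.subset_span ⟨n, rfl⟩)
  refine ⟨HilbertBasis.mk hon ?_, fun n => ?_⟩
  · rw [← hd]
    exact Submodule.topologicalClosure_mono hle
  · rw [HilbertBasis.coe_mk, smul_inv_smul₀ (hne' n)]

/-- Orthogonal systems with dense span and equal norms are matched by a unitary operator. -/
theorem exists_linearIsometryEquiv {a : ℕ → E} {a' : ℕ → F}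
    (ho : ∀ n k, n ≠ k → inner ℂ (a n) (a k) = 0) (ho' : ∀ n k, n ≠ k → inner ℂ (a' n) (a' k) = 0)
    (hne : ∀ n, 0 < ‖a n‖) (heq : ∀ n, ‖a' n‖ = ‖a n‖)
    (hd : (Submodule.span ℂ (Set.range a)).topologicalClosure = ⊤)
    (hd' : (Submodule.span ℂ (Set.range a')).topologicalClosure = ⊤) :
    ∃ U : E ≃ₗᵢ[ℂ] F, ∀ n, U (a n) = a' n := by
  obtain ⟨b, hb⟩ := exists_hilbertBasis_of_orthogonal ho hne hd
  obtain ⟨b', hb'⟩ := exists_hilbertBasis_of_orthogonal ho' (fun n => heq n ▸ hne n) hd'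
  refine ⟨b.repr.trans b'.repr.symm, fun n => ?_⟩
  rw [hb, hb', map_smul, heq, LinearIsometryEquiv.trans_apply, HilbertBasis.repr_self,
    HilbertBasis.repr_symm_single]

end unitary

/-! ### Orthogonality of the Al-Salam–Chihara polynomials -/

open Polynomial in
/-- The polynomials `h_n(·; q^τ, q^σ | q²)`, defined by their recurrence. -/
noncomputable def chiharaPoly (q τ σ : ℝ) : ℕ → Polynomial ℝ
  | 0 => 1
  | 1 => C 2 * X - C (q / q ^ τ * (q ^ σ - (q ^ σ)⁻¹))
  | n + 2 => (C 2 * X - C (q / q ^ τ * (q ^ σ - (q ^ σ)⁻¹) * q ^ (2 * (n + 1))))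
      * chiharaPoly q τ σ (n + 1) - C (recCoeff q τ (n + 1)) * chiharaPoly q τ σ n

section chiharaPoly
variable {q : ℝ} (hq : q ∈ Set.Ioo (0 : ℝ) 1) (τ σ : ℝ)

open Polynomial in
theorem two_X_mul_chiharaPoly (q τ σ : ℝ) (n : ℕ) :
    C 2 * X * chiharaPoly q τ σ n = chiharaPoly q τ σ (n + 1)
      + C (q / q ^ τ * (q ^ σ - (q ^ σ)⁻¹) * q ^ (2 * n)) * chiharaPoly q τ σ n
      + C (recCoeff q τ n) * chiharaPoly q τ σ (n - 1) := by
  rcases n with _ | n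
  · simp [chiharaPoly, recCoeff]
  · simp only [chiharaPoly, Nat.add_sub_cancel]
    ring

theorem X_mul_chiharaPoly (q τ σ : ℝ) (n : ℕ) :
    Polynomial.X * chiharaPoly q τ σ n = (2 : ℝ)⁻¹ • (chiharaPoly q τ σ (n + 1)
      + (q / q ^ τ * (q ^ σ - (q ^ σ)⁻¹) * q ^ (2 * n)) • chiharaPoly q τ σ n
      + recCoeff q τ n • chiharaPoly q τ σ (n - 1)) := by
  rw [eq_inv_smul_iff₀ two_ne_zero, Polynomial.smul_eq_C_mul, Polynomial.smul_eq_C_mul,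
    Polynomial.smul_eq_C_mul, ← mul_assoc, two_X_mul_chiharaPoly]

include hq in
theorem eval_chiharaPoly (n : ℕ) (x : ℝ) : (chiharaPoly q τ σ n).eval x = chihara q τ σ n x := by
  have hstep : ∀ n, (chiharaPoly q τ σ n).eval x = chihara q τ σ n x →
      (recCoeff q τ n * (chiharaPoly q τ σ (n - 1)).eval x =
        recCoeff q τ n * chihara q τ σ (n - 1) x) →
      (chiharaPoly q τ σ (n + 1)).eval x = chihara q τ σ (n + 1) x := by
    intro n h h'
    have h1 := congrArg (Polynomial.eval x) (two_X_mul_chiharaPoly q τ σ n)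
    have h2 := chihara_recurrence hq τ σ x n
    simp only [Polynomial.eval_mul, Polynomial.eval_add, Polynomial.eval_C, Polynomial.eval_X, h,
      h'] at h1
    linarith
  have h0 : (chiharaPoly q τ σ 0).eval x = chihara q τ σ 0 x := by
    rw [chihara_zero, chiharaPoly, Polynomial.eval_one]
  induction n using Nat.twoStepInduction with
  | zero => exact h0
  | one => exact hstep 0 h0 (by rw [Nat.zero_sub, h0])
  | more n ih ih' => exact hstep (n + 1) ih' (by rw [Nat.add_sub_cancel, ih])

theorem span_chiharaPoly (q τ σ : ℝ) :
    Submodule.span ℝ (Set.range (chiharaPoly q τ σ)) = ⊤ := by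
  set S := Submodule.span ℝ (Set.range (chiharaPoly q τ σ))
  have hmem : ∀ n, chiharaPoly q τ σ n ∈ S := fun n => Submodule.subset_span ⟨n, rfl⟩
  have hX : ∀ P ∈ S, Polynomial.X * P ∈ S := by
    intro P hP
    induction hP using Submodule.span_induction with
    | mem P hP =>
      obtain ⟨n, rfl⟩ := hP
      rw [X_mul_chiharaPoly]
      exact S.smul_mem _ (S.add_mem (S.add_mem (hmem _) (S.smul_mem _ (hmem _)))
        (S.smul_mem _ (hmem _)))
    | zero => rw [mul_zero]; exact S.zero_mem
    | add P Q _ _ hP hQ => rw [mul_add]; exact S.add_mem hP hQ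
    | smul c P _ hP => rw [mul_smul_comm]; exact S.smul_mem _ hP
  rw [eq_top_iff]
  intro P _
  induction P using Polynomial.induction_on with
  | C a =>
    rw [← mul_one (Polynomial.C a), ← Polynomial.smul_eq_C_mul]
    exact S.smul_mem _ (hmem 0)
  | add P Q hP hQ => exact S.add_mem (hP trivial) (hQ trivial)
  | monomial n a h =>
    rw [pow_succ', mul_left_comm]
    exact hX _ (h trivial)

omit hq in
/-- If an operator `T` acts on the vectors `u^n v_n` by the recurrence of the `h_n`, then these
vectors are the `h_n(T) v_0`. -/
theorem aeval_chiharaPoly {E : Type*} [NormedAddCommGroup E] [InnerProductSpace ℂ E]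
    {T : E →L[ℂ] E} {v : ℕ → E} {u : ℂ} (hu : u ≠ 0)
    (hT : ∀ n, T (v n) = (2 : ℂ)⁻¹ • (u • v (n + 1)
        + ((q / q ^ τ * (q ^ σ - (q ^ σ)⁻¹) * q ^ (2 * n) : ℝ) : ℂ) • v n
        + (u⁻¹ * (recCoeff q τ n : ℂ)) • v (n - 1))) (n : ℕ) :
    Polynomial.aeval T (chiharaPoly q τ σ n) (v 0) = u ^ n • v n := by
  have hc : ∀ n, (recCoeff q τ n : ℂ) * u ^ n * u⁻¹ = recCoeff q τ n * u ^ (n - 1) := by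
    intro n
    rcases n with _ | n
    · simp [recCoeff]
    · rw [Nat.add_sub_cancel, pow_succ]
      field_simp
  have hstep : ∀ n, Polynomial.aeval T (chiharaPoly q τ σ n) (v 0) = u ^ n • v n →
      ((recCoeff q τ n : ℂ) • Polynomial.aeval T (chiharaPoly q τ σ (n - 1)) (v 0) =
        (recCoeff q τ n : ℂ) • u ^ (n - 1) • v (n - 1)) →
      Polynomial.aeval T (chiharaPoly q τ σ (n + 1)) (v 0) = u ^ (n + 1) • v (n + 1) := by
    intro n h h'
    have h1 := congrArg (fun P => Polynomial.aeval T P (v 0)) (two_X_mul_chiharaPoly q τ σ n)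
    have hr : ∀ (r : ℝ) (x : E), r • x = (r : ℂ) • x := fun r x => (Complex.coe_smul r x).symm
    simp only [← Polynomial.smul_eq_C_mul, map_add, map_smul, map_mul, Polynomial.aeval_X,
      smul_mul_assoc, add_apply, smul_apply, mul_apply_eq_comp, hr, h, h', hT] at h1
    rw [← sub_eq_iff_eq_add, ← sub_eq_iff_eq_add] at h1
    rw [← h1]
    match_scalars
    · ring
    · ring
    · linear_combination hc n
  have h0 : Polynomial.aeval T (chiharaPoly q τ σ 0) (v 0) = u ^ 0 • v 0 := by
    rw [chiharaPoly, map_one, pow_zero, one_smul]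
    rfl
  induction n using Nat.twoStepInduction with
  | zero => exact h0
  | one => exact hstep 0 h0 (by rw [Nat.zero_sub, h0])
  | more n ih ih' => exact hstep (n + 1) ih' (by rw [Nat.add_sub_cancel, ih])

end chiharaPoly

/-! ### Existence and uniqueness of the orthogonality measure -/

section orthMeasure
variable {q : ℝ} (hq : q ∈ Set.Ioo (0 : ℝ) 1) {τ σ : ℝ} {m : Measure ℝ}

theorem IsOrthMeasure.isFiniteMeasure (h : IsOrthMeasure q τ σ m) : IsFiniteMeasure m :=
  ⟨by rw [h.total_mass]; exact ENNReal.ofReal_lt_top⟩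

theorem IsOrthMeasure.integrable (h : IsOrthMeasure q τ σ m) (P : Polynomial ℝ) :
    Integrable (fun x => P.eval x) m := by
  simp only [Polynomial.eval_eq_sum_range]
  exact integrable_finsetSum _ fun n _ => (h.integrable_pow n).const_mul _

/-- Integration of polynomials as a linear functional. -/
noncomputable def polyIntegral (h : IsOrthMeasure q τ σ m) : Polynomial ℝ →ₗ[ℝ] ℝ where
  toFun P := ∫ x, P.eval x ∂m
  map_add' P Q := by
    simp only [Polynomial.eval_add]
    exact integral_add (h.integrable P) (h.integrable Q)
  map_smul' c P := by
    simp only [Polynomial.eval_smul, smul_eq_mul, RingHom.id_apply]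
    exact integral_const_mul _ _

include hq

theorem IsOrthMeasure.integral_mul_eq_zero (h : IsOrthMeasure q τ σ m) {n k : ℕ} (hnk : n ≠ k) :
    ∫ x, (chiharaPoly q τ σ n * chiharaPoly q τ σ k).eval x ∂m = 0 := by
  simp only [Polynomial.eval_mul, eval_chiharaPoly hq]
  exact h.orthogonal n k hnk

theorem qPochInf_nonneg (τ : ℝ) : 0 ≤ qPochInf (-(q ^ (2 * τ))) (q ^ 2) := by
  obtain ⟨v, hv, -⟩ := existsUnique_isEigenSeq hq τ
  rw [← hv.norm_sq_zero]
  positivity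

theorem IsOrthMeasure.integral_one (h : IsOrthMeasure q τ σ m) :
    ∫ x, (1 : Polynomial ℝ).eval x ∂m = qPochInf (-(q ^ (2 * τ))) (q ^ 2) := by
  simp only [Polynomial.eval_one, integral_const, smul_eq_mul, mul_one, measureReal_def,
    h.total_mass, ENNReal.toReal_ofReal (qPochInf_nonneg hq τ)]

/-- Orthogonality and the total mass determine all moments. -/
theorem IsOrthMeasure.integral_eq {m' : Measure ℝ} (h : IsOrthMeasure q τ σ m)
    (h' : IsOrthMeasure q τ σ m') (P : Polynomial ℝ) : ∫ x, P.eval x ∂m = ∫ x, P.eval x ∂m' := by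
  have : polyIntegral h = polyIntegral h' := by
    refine LinearMap.ext_on_range (span_chiharaPoly q τ σ) fun n => ?_
    change ∫ x, _ ∂m = ∫ x, _ ∂m'
    rcases eq_or_ne n 0 with rfl | hn
    · rw [chiharaPoly, h.integral_one hq, h'.integral_one hq]
    · have h1 := h.integral_mul_eq_zero hq hn
      have h2 := h'.integral_mul_eq_zero hq hn
      rw [chiharaPoly, mul_one] at h1 h2
      rw [h1, h2]
  exact DFunLike.congr_fun this P

/-- The spectral measure of `(π ⊗ τ_0) Δ(ρ_{τ,σ})` at `v_0` is an orthogonality measure. -/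
theorem exists_isOrthMeasure (τ σ : ℝ) : ∃ m : Measure ℝ, IsOrthMeasure q τ σ m ∧
    ∃ C B : ℝ, 0 ≤ B ∧ ∀ n : ℕ, ∫ x, x ^ n ∂m ≤ C * B ^ n := by
  obtain ⟨v, hv, -⟩ := existsUnique_isEigenSeq hq τ
  set T := repComul hq (0 / 2) (rho q τ σ) with hTdef
  have hT : IsSelfAdjoint T :=
    (ContinuousLinearMap.isSelfAdjoint_iff').mpr (adjoint_repComul_rho hq τ σ 0)
  obtain ⟨m, hfin, hm⟩ := exists_spectralMeasure hT (v 0)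
  have hpow : ∀ n : ℕ, ∫ x, x ^ n ∂m = (inner ℂ (v 0) ((T ^ n) (v 0))).re := fun n => by
    simpa using (hm (Polynomial.X ^ n)).2
  refine ⟨m, ⟨fun n => by simpa using (hm (Polynomial.X ^ n)).1, fun n k hnk => ?_, ?_⟩,
    ‖v 0‖ ^ 2, ‖T‖, norm_nonneg _, fun n => ?_⟩
  · have h1 := (hm (chiharaPoly q τ σ n * chiharaPoly q τ σ k)).2
    simp only [Polynomial.eval_mul, eval_chiharaPoly hq] at h1
    refine h1.trans ?_
    have hadj := adjoint_aeval hT (chiharaPoly q τ σ n)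
    have hq0 : (q : ℂ) ≠ 0 := by exact_mod_cast hq.1.ne'
    have ha := fun j => aeval_chiharaPoly (q := q) τ σ hq0 (T := T) (v := v) (fun n => by
      rw [hv.repComul_rho_apply]
      simp) j
    rw [map_mul, mul_apply_eq_comp, ← hadj, ContinuousLinearMap.adjoint_inner_right,
      ha, ha, inner_smul_left, inner_smul_right, hv.inner_eq_zero hnk, mul_zero, mul_zero,
      Complex.zero_re]
  · have h1 := hpow 0
    simp only [pow_zero, integral_const, smul_eq_mul, mul_one, one_apply_eq_self] at h1
    rw [inner_self_eq_norm_sq_complex, Complex.ofReal_re, hv.norm_sq_zero] at h1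
    rw [← h1, ofReal_measureReal]
  · rw [hpow]
    exact (le_abs_self _).trans (abs_inner_pow_le T (v 0) n)

/-- All orthogonality measures are concentrated on one bounded interval. -/
theorem exists_ae_abs_le (τ σ : ℝ) :
    ∃ B : ℝ, ∀ m' : Measure ℝ, IsOrthMeasure q τ σ m' → ∀ᵐ x ∂m', |x| ≤ B := by
  obtain ⟨m₀, h₀, C, B, hB, hC⟩ := exists_isOrthMeasure hq τ σ
  refine ⟨B, fun m' h' => ?_⟩
  have := h'.isFiniteMeasure
  refine ae_abs_le_of_moments hB h'.integrable_pow (C := C) fun n => ?_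
  have := h'.integral_eq hq h₀ (Polynomial.X ^ n)
  simp only [Polynomial.eval_pow, Polynomial.eval_X] at this
  rw [this]
  exact hC n

theorem existsUnique_isOrthMeasure (τ σ : ℝ) : ∃! m : Measure ℝ, IsOrthMeasure q τ σ m := by
  obtain ⟨m, h, -⟩ := exists_isOrthMeasure hq τ σ
  refine ⟨m, h, fun m' h' => ?_⟩
  obtain ⟨B, hB⟩ := exists_ae_abs_le hq τ σ
  have := h.isFiniteMeasure
  have := h'.isFiniteMeasure
  exact eq_of_integral_polynomial_eq (hB m' h') (hB m h) h'.integrable h.integrable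
    (h'.integral_eq hq h)

/-- The squared norms of the `h_n` satisfy `‖h_{n+1}‖² = c_{n+1} ‖h_n‖²`, where `c_n` is the
recurrence coefficient: evaluate `∫ 2x h_n h_{n+1}` in two ways. -/
theorem IsOrthMeasure.integral_sq_succ (h : IsOrthMeasure q τ σ m) (n : ℕ) :
    ∫ x, (chiharaPoly q τ σ (n + 1) * chiharaPoly q τ σ (n + 1)).eval x ∂m =
      recCoeff q τ (n + 1) * ∫ x, (chiharaPoly q τ σ n * chiharaPoly q τ σ n).eval x ∂m := by
  set I := polyIntegral h
  set p := chiharaPoly q τ σ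
  change I (p (n + 1) * p (n + 1)) = recCoeff q τ (n + 1) * I (p n * p n)
  have ho : ∀ j k, j ≠ k → I (p j * p k) = 0 := fun j k hjk => h.integral_mul_eq_zero hq hjk
  have hX : ∀ k, Polynomial.X * p k = _ := X_mul_chiharaPoly q τ σ
  have hz : ∀ k : ℕ, recCoeff q τ k * I (p (k - 1) * p (k + 1)) = 0 := fun k => by
    rw [ho _ _ (by omega), mul_zero]
  have h1 : I (Polynomial.X * p n * p (n + 1)) = 2⁻¹ * I (p (n + 1) * p (n + 1)) := by
    rw [hX, smul_mul_assoc, map_smul, add_mul, add_mul, smul_mul_assoc, smul_mul_assoc, map_add,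
      map_add, map_smul, map_smul, ho n (n + 1) (by omega), smul_eq_mul, smul_eq_mul,
      smul_eq_mul, hz, mul_zero, add_zero, add_zero]
  have h2 : I (Polynomial.X * p (n + 1) * p n) = 2⁻¹ * (recCoeff q τ (n + 1) * I (p n * p n)) := by
    rw [hX, smul_mul_assoc, map_smul, add_mul, add_mul, smul_mul_assoc, smul_mul_assoc, map_add,
      map_add, map_smul, map_smul, ho (n + 1) n (by omega), ho (n + 1 + 1) n (by omega),
      smul_eq_mul, smul_eq_mul, smul_eq_mul, mul_zero, zero_add, zero_add, Nat.add_sub_cancel]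
  have h3 : Polynomial.X * p n * p (n + 1) = Polynomial.X * p (n + 1) * p n := by ring
  rw [h3, h2] at h1
  linarith

end orthMeasure

end QSU2

/-! ### The unitary operator `Λ` -/

theorem proposition3p3 (q : ℝ) (hq : q ∈ Set.Ioo (0 : ℝ) 1) (τ σ φ : ℝ) :
    -- the vectors `v_n(q^τ)` and the measure `dm` exist and are unique
    (∃! v : ℕ → QSU2.Ell2, QSU2.IsEigenSeq hq τ v) ∧
    (∃! m : Measure ℝ, QSU2.IsOrthMeasure q τ σ m) ∧
    ∀ (v : ℕ → QSU2.Ell2) (m : Measure ℝ),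
      QSU2.IsEigenSeq hq τ v → QSU2.IsOrthMeasure q τ σ m →
      -- the multiplication operator `M` on `L²(dm)`
      ∃ M : Lp ℂ 2 m →L[ℂ] Lp ℂ 2 m,
        (∀ f : Lp ℂ 2 m, M f =ᵐ[m] fun x : ℝ => (x : ℂ) * f x) ∧
        -- the unitary operator `Λ : V₁ → L²(dm)`
        ∃ Λ : QSU2.closedSpan v ≃ₗᵢ[ℂ] Lp ℂ 2 m,
          (∀ n : ℕ, Λ ⟨v n, QSU2.mem_closedSpan v n⟩ =ᵐ[m] fun x : ℝ =>
            ((q : ℂ) ^ n)⁻¹ * Complex.exp (Complex.I * n * φ) *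
              (QSU2.alSalamChihara n (q ^ τ) (q ^ σ) (q ^ 2) x : ℂ)) ∧
          -- `V₁` is invariant under `T = (π ⊗ τ_{φ/2}) Δ(ρ_{τ,σ})`, and `Λ T = M Λ`
          ∀ w : QSU2.closedSpan v,
            ∃ h : QSU2.repComul hq (φ / 2) (QSU2.rho q τ σ) w ∈ QSU2.closedSpan v,
              Λ ⟨QSU2.repComul hq (φ / 2) (QSU2.rho q τ σ) w, h⟩ = M (Λ w) := by
  refine ⟨QSU2.existsUnique_isEigenSeq hq τ, QSU2.existsUnique_isOrthMeasure hq τ σ,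
    fun v m hv h => ?_⟩
  obtain ⟨B, hB⟩ := QSU2.exists_ae_abs_le hq τ σ
  replace hB := hB m h
  have := h.isFiniteMeasure
  have hq0 : (q : ℂ) ≠ 0 := by exact_mod_cast hq.1.ne'
  refine ⟨QSU2.mulX hB, QSU2.coeFn_mulX hB, ?_⟩
  -- the two orthogonal systems
  let V := QSU2.closedSpan v
  have : CompleteSpace V := (Submodule.isClosed_topologicalClosure _).completeSpace_coe
  let a : ℕ → V := fun n => ⟨v n, QSU2.mem_closedSpan v n⟩
  let z : ℕ → ℂ := fun n => ((q : ℂ) ^ n)⁻¹ * Complex.exp (Complex.I * n * φ)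
  have hz0 : ∀ n, z n ≠ 0 := fun n =>
    mul_ne_zero (inv_ne_zero (pow_ne_zero n hq0)) (Complex.exp_ne_zero _)
  let u : ℕ → Lp ℂ 2 m := fun n => z n • QSU2.polyLp hB (QSU2.chiharaPoly q τ σ n)
  have hoa : ∀ n k, n ≠ k → inner ℂ (a n) (a k) = 0 := fun n k hnk => hv.inner_eq_zero hnk
  have hou : ∀ n k, n ≠ k → inner ℂ (u n) (u k) = 0 := fun n k hnk => by
    rw [inner_smul_left, inner_smul_right, QSU2.inner_polyLp, h.integral_mul_eq_zero hq hnk]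
    simp
  have hzpow : ∀ n, z n = (Complex.exp (Complex.I * φ) * (q : ℂ)⁻¹) ^ n := fun n => by
    rw [mul_pow, ← Complex.exp_nat_mul, inv_pow, mul_comm]
    simp only [z]
    congr 2
    ring
  have hzup : ∀ n, Complex.exp (-(Complex.I * φ)) * q * z (n + 1) = z n := fun n => by
    have := Complex.exp_ne_zero (Complex.I * φ)
    rw [hzpow, hzpow, pow_succ, Complex.exp_neg]
    field_simp
  -- for `n = 0` both sides vanish
  have hzdown : ∀ n, Complex.exp (Complex.I * φ) * ((q : ℂ)⁻¹ * (QSU2.recCoeff q τ n : ℂ)) *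
      z (n - 1) = QSU2.recCoeff q τ n * z n := fun n => by
    rcases n with _ | n
    · simp [QSU2.recCoeff]
    · rw [Nat.add_sub_cancel, hzpow, hzpow, pow_succ]
      ring
  have hznorm : ∀ n, ‖z n‖ ^ 2 = (q ^ (2 * n))⁻¹ := fun n => by
    have : Complex.I * n * φ = ((n * φ : ℝ) : ℂ) * Complex.I := by push_cast; ring
    simp only [z]
    rw [norm_mul, this, Complex.norm_exp_ofReal_mul_I, mul_one, norm_inv, norm_pow,
      Complex.norm_real, Real.norm_of_nonneg hq.1.le, inv_pow, ← pow_mul, mul_comm]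
  have hunorm : ∀ n, ‖u n‖ ^ 2 = (q ^ (2 * n))⁻¹ *
      ∫ x, (QSU2.chiharaPoly q τ σ n * QSU2.chiharaPoly q τ σ n).eval x ∂m := fun n => by
    rw [norm_smul, mul_pow, hznorm]
    congr 1
    have h1 := QSU2.inner_polyLp hB (QSU2.chiharaPoly q τ σ n) (QSU2.chiharaPoly q τ σ n)
    rw [QSU2.inner_self_eq_norm_sq_complex] at h1
    exact Complex.ofReal_injective h1
  have hsq : ∀ n, ‖u n‖ ^ 2 = ‖v n‖ ^ 2 := by
    intro n
    induction n with
    | zero =>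
      rw [hunorm, hv.norm_sq_zero, ← h.integral_one hq]
      simp [QSU2.chiharaPoly]
    | succ n ih =>
      rw [hunorm] at ih
      rw [hunorm, h.integral_sq_succ hq, hv.norm_sq_succ, ← ih, mul_add, pow_add]
      have := hq.1.ne'
      field_simp
      ring
  have heq : ∀ n, ‖u n‖ = ‖a n‖ := fun n =>
    (sq_eq_sq₀ (norm_nonneg _) (norm_nonneg _)).mp (hsq n)
  have hda : (Submodule.span ℂ (Set.range a)).topologicalClosure = ⊤ := by
    rw [Submodule.eq_top_iff']
    intro w
    change w ∈ closure ((Submodule.span ℂ (Set.range a) : Submodule ℂ V) : Set V)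
    rw [closure_subtype]
    have himage : Subtype.val '' ((Submodule.span ℂ (Set.range a) : Submodule ℂ V) : Set V) =
        (Submodule.span ℂ (Set.range v) : Set QSU2.Ell2) := by
      change ((Submodule.span ℂ (Set.range a)).map V.subtype : Set QSU2.Ell2) = _
      rw [Submodule.map_span, ← Set.range_comp]
      rfl
    rw [himage]
    exact w.2
  have hdu : (Submodule.span ℂ (Set.range u)).topologicalClosure = ⊤ := by
    refine QSU2.eq_top_of_polyLp_mem hB (Submodule.isClosed_topologicalClosure _) fun P => ?_
    set K := (Submodule.span ℂ (Set.range u)).topologicalClosure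
    have hle : Submodule.span ℝ (Set.range (QSU2.chiharaPoly q τ σ)) ≤
        (K.restrictScalars ℝ).comap (QSU2.polyLp hB) := by
      rw [Submodule.span_le]
      rintro _ ⟨n, rfl⟩
      change QSU2.polyLp hB (QSU2.chiharaPoly q τ σ n) ∈ K
      rw [← inv_smul_smul₀ (hz0 n) (QSU2.polyLp hB (QSU2.chiharaPoly q τ σ n))]
      exact K.smul_mem _ (Submodule.le_topologicalClosure _ (Submodule.subset_span ⟨n, rfl⟩))
    rw [QSU2.span_chiharaPoly] at hle
    exact hle (Submodule.mem_top (x := P))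
  obtain ⟨U, hU⟩ := QSU2.exists_linearIsometryEquiv hoa hou hv.norm_pos heq hda hdu
  refine ⟨U, fun n => ?_, ?_⟩
  · rw [show U ⟨v n, QSU2.mem_closedSpan v n⟩ = u n from hU n]
    filter_upwards [Lp.coeFn_smul (z n) (QSU2.polyLp hB (QSU2.chiharaPoly q τ σ n)),
      QSU2.coeFn_polyLp hB (QSU2.chiharaPoly q τ σ n)] with x h1 h2
    rw [h1, Pi.smul_apply, h2, QSU2.eval_chiharaPoly hq]
    rfl
  · set T := QSU2.repComul hq (φ / 2) (QSU2.rho q τ σ)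
    have hTv : ∀ n, T (v n) ∈ V := fun n => by
      rw [hv.repComul_rho_apply]
      exact V.smul_mem _ (V.add_mem (V.add_mem (V.smul_mem _ (QSU2.mem_closedSpan v _))
        (V.smul_mem _ (QSU2.mem_closedSpan v _))) (V.smul_mem _ (QSU2.mem_closedSpan v _)))
    have hT : ∀ w ∈ V, T w ∈ V := by
      have hle : V ≤ V.comap (T : QSU2.Ell2 →ₗ[ℂ] QSU2.Ell2) := by
        refine Submodule.topologicalClosure_minimal _ ?_ ?_
        · rw [Submodule.span_le]
          rintro _ ⟨n, rfl⟩
          exact hTv n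
        · exact (Submodule.isClosed_topologicalClosure _).preimage T.continuous
      exact fun w hw => hle hw
    let TV : V →L[ℂ] V := (T.comp V.subtypeL).codRestrict V fun w => hT w w.2
    have hcomm : (U.toContinuousLinearEquiv : V →L[ℂ] Lp ℂ 2 m).comp TV =
        (QSU2.mulX hB).comp (U.toContinuousLinearEquiv : V →L[ℂ] Lp ℂ 2 m) := by
      refine ContinuousLinearMap.ext_on (s := Set.range a) ?_ ?_
      · exact (Submodule.dense_iff_topologicalClosure_eq_top).mpr hda
      · rintro _ ⟨n, rfl⟩
        change U (TV (a n)) = QSU2.mulX hB (U (a n))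
        have hTa : TV (a n) = (2 : ℂ)⁻¹ • ((Complex.exp (-(Complex.I * φ)) * q) • a (n + 1)
            + ((q / q ^ τ * (q ^ σ - (q ^ σ)⁻¹) * q ^ (2 * n) : ℝ) : ℂ) • a n
            + (Complex.exp (Complex.I * φ) * ((q⁻¹ * QSU2.recCoeff q τ n : ℝ) : ℂ)) • a (n - 1)) :=
          Subtype.ext (hv.repComul_rho_apply σ φ n)
        rw [hTa, hU]
        simp only [map_smul, map_add, hU]
        simp only [u, map_smul, QSU2.mulX_polyLp]
        rw [QSU2.X_mul_chiharaPoly]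
        simp only [map_smul, map_add]
        have hr : ∀ (r : ℝ) (x : Lp ℂ 2 m), r • x = (r : ℂ) • x :=
          fun r x => (Complex.coe_smul r x).symm
        simp only [hr]
        have hdown := hzdown n
        have hup := hzup n
        match_scalars
        · linear_combination (2 : ℂ)⁻¹ * hup
        ·     ring
        ·     linear_combination (2 : ℂ)⁻¹ * hdown
    exact fun w => ⟨hT w w.2, DFunLike.congr_fun hcomm w⟩
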